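/- Let $1\le n\le N$ and $s\ge 0$ be integers and let $X$ be a smooth manifold of dimension $N$. For $r\ge 0$ let $T^r_nX$ be the manifold of $(r,n)$-velocities, i.e. of $r$-jets $j^r_0\gamma$ at $0\in\mathbb R^n$ of smooth maps $\gamma$ from neighbourhoods of $0$ to $X$; every chart $(V,\psi=(x^A))$ of $X$ gives an associated chart $V^r$ of $T^r_nX$ with coordinates $x^A_{j_1\dots j_k}(j^r_0\gamma)=\partial_{j_1}\cdots\partial_{j_k}(x^A\circ\gamma)(0)$, $0\le k\le r$ (symmetric in the indices; the independent ones are those with $j_1\le\dots\le j_k$). Let $\tau^{t,s}:T^t_nX\to T^s_nX$, $j^t_0\gamma\mapsto j^s_0\gamma$ ($t\ge s$). Sums over multi-indices $J$ with $|J|=k$ are sums over all $k$-tuples $(j_1,\dots,j_k)\in\{1,\dots,n\}^k$, and repeated indices $A,B\in\{1,\dots,N\}$ are summed. In the chart $V^t$ put $$\partial^{j_1\dots j_k}_A=\frac{r_1!\cdots r_n!}{k!}\,\frac{\partial}{\partial x^A_{j_1\dots j_k}}$$ with $r_i$ the number of times $i$ occurs among $j_1,\dots,j_k$, and $$d_i=\sum_{|J|\le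 t-1}x^A_{iJ}\,\partial^J_A,\qquad d_{(j_1,\dots,j_k)}=d_{j_1}\cdots d_{j_k}.$$ For a function $f$ depending only on the coordinates of order at most $s$, and $|J|\le s$, put $$\mathcal E^J_A(f)=\sum_{|K|\le s-|J|}(-1)^{|K|}\binom{|J|+|K|}{|J|}\,d_K\,\partial^{JK}_A f .$$ Let $W\subseteq T^s_nX$ be open (for instance $W=T^s_nX$, or the set of regular velocities, i.e. of jets of immersions) and let $\mathcal T$ be a differential equation on $W$, i.e. a smooth $1$-form on $W$ that has in every associated chart the form $\mathcal T=\mathcal T_A\,dx^A$. Let $t\ge 2s$, and in every chart $V^t$ define (with $\mathcal T_A$ pulled back by $\tau^{t,s}$) $$\mathcal H^J_{AB}=\partial^J_B\mathcal T_A-(-1)^{|J|}\,\mathcal E^J_A(\mathcal T_B),\qquad |J|\le s .$$ Then there exists a globally defined smooth $2$-form $\mathcal H(\mathcal T)$ on $(\tau^{t,s})^{-1}(W)\subseteq T^t_nX$ (so on all of $T^t_nX$ if $W=T^s_nX$) such that in every associated chart $V^t$ $$\mathcal H(\mathcal T)=\sum_{|J|\le s}\mathcal H^J_{AB}\,dx^B_J\wedge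 dx^A .$$ -/

import Mathlib

open scoped Manifold ContDiff Topology Nat

namespace HelmholtzSonin

/-- Unordered multi-indices `J = {j₁, …, j_k}` with entries in `{1, …, n}` and `|J| = k ≤ r`;
they label the independent symmetric components `x_{j₁ … j_k}`, `j₁ ≤ ⋯ ≤ j_k`. -/
abbrev MultiIndex (n r : ℕ) : Type := {J : Multiset (Fin n) // Multiset.card J ≤ r}

instance (n r : ℕ) : Finite (MultiIndex n r) := by
  refine Finite.of_injective
    (fun J : MultiIndex n r ↦ fun i : Fin n ↦
      (⟨J.1.count i, Nat.lt_succ_of_le ((Multiset.count_le_card i J.1).trans J.2)⟩ : Fin (r + 1)))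
    fun J K h ↦ Subtype.ext (Multiset.ext.2 fun i ↦ ?_)
  exact congrArg Fin.val (congrFun h i)

noncomputable instance (n r : ℕ) : Fintype (MultiIndex n r) := Fintype.ofFinite _

/-- The space of the coordinates `(x^A_J)`, `1 ≤ A ≤ N`, `|J| ≤ r`: the model space of the manifold
of `(r, n)`-velocities of an `N`-dimensional manifold. -/
abbrev JetCoord (N n r : ℕ) : Type := Fin N → MultiIndex n r → ℝ

/-- The iterated partial derivative `∂^k f / ∂t^{j₁} ⋯ ∂t^{j_k}` for a list `[j₁, …, j_k]`. -/
noncomputable def iterPartial {n : ℕ} :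
    List (Fin n) → (EuclideanSpace ℝ (Fin n) → ℝ) → EuclideanSpace ℝ (Fin n) → ℝ
  | [], f => f
  | i :: L, f => fun t ↦ fderiv ℝ (iterPartial L f) t (EuclideanSpace.single i 1)

/-- The `i`-th coordinate function on `ℝ^m`. -/
noncomputable abbrev coordProj (m : ℕ) (i : Fin m) : EuclideanSpace ℝ (Fin m) →L[ℝ] ℝ :=
  EuclideanSpace.proj i

set_option linter.unusedSectionVars false

section partials
variable {n : ℕ}

theorem iterPartial_contDiffOn {G : Type*} [NormedAddCommGroup G] [NormedSpace ℝ G]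
    {U : Set (G × EuclideanSpace ℝ (Fin n))} (hU : IsOpen U)
    {g : G × EuclideanSpace ℝ (Fin n) → ℝ} (hg : ContDiffOn ℝ ∞ g U) (L : List (Fin n)) :
    ContDiffOn ℝ ∞ (fun q ↦ iterPartial L (fun t ↦ g (q.1, t)) q.2) U := by
  induction L with
  | nil => simpa [iterPartial] using hg
  | cons i L ih =>
    have h1 : ContDiffOn ℝ ∞ (fun q ↦ fderiv ℝ
        (fun q : G × EuclideanSpace ℝ (Fin n) ↦ iterPartial L (fun t ↦ g (q.1, t)) q.2) q
        ((0 : G), EuclideanSpace.single i (1 : ℝ))) U :=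
      (ih.fderiv_of_isOpen hU (by simp)).clm_apply contDiffOn_const
    refine h1.congr fun q hq ↦ ?_
    have hd := ((ih q hq).contDiffAt (hU.mem_nhds hq)).differentiableAt (by simp)
    have hc : HasFDerivAt (fun t : EuclideanSpace ℝ (Fin n) ↦ (q.1, t))
        (ContinuousLinearMap.inr ℝ G _) q.2 := hasFDerivAt_prodMk_right q.1 q.2
    have := (HasFDerivAt.comp q.2 (f := fun t : EuclideanSpace ℝ (Fin n) ↦ (q.1, t))
      hd.hasFDerivAt hc).fderiv
    simp only [iterPartial]
    have h2 : ((fun q : G × EuclideanSpace ℝ (Fin n) ↦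
        iterPartial L (fun t ↦ g (q.1, t)) q.2) ∘ fun t ↦ (q.1, t)) =
        iterPartial L (fun t ↦ g (q.1, t)) := rfl
    rw [h2] at this
    rw [this]; simp

theorem iterPartial_smooth {U : Set (EuclideanSpace ℝ (Fin n))} (hU : IsOpen U)
    {f : EuclideanSpace ℝ (Fin n) → ℝ} (hf : ContDiffOn ℝ ∞ f U) (L : List (Fin n)) :
    ContDiffOn ℝ ∞ (iterPartial L f) U := by
  induction L with
  | nil => exact hf
  | cons i L ih => exact (ih.fderiv_of_isOpen hU (by simp)).clm_apply contDiffOn_const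

theorem iterPartial_congr {U : Set (EuclideanSpace ℝ (Fin n))} (hU : IsOpen U)
    {f g : EuclideanSpace ℝ (Fin n) → ℝ} (h : Set.EqOn f g U) (L : List (Fin n)) :
    Set.EqOn (iterPartial L f) (iterPartial L g) U := by
  induction L with
  | nil => exact h
  | cons i L ih =>
    intro t ht
    have := (ih.eventuallyEq_of_mem (hU.mem_nhds ht)).fderiv_eq (𝕜 := ℝ)
    simp only [iterPartial, this]

theorem iterPartial_perm {U : Set (EuclideanSpace ℝ (Fin n))} (hU : IsOpen U)
    {f : EuclideanSpace ℝ (Fin n) → ℝ} (hf : ContDiffOn ℝ ∞ f U) {L L' : List (Fin n)}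
    (h : L.Perm L') : Set.EqOn (iterPartial L f) (iterPartial L' f) U := by
  induction h with
  | nil => intro t _; rfl
  | cons i _ ih =>
    intro t ht
    have := (ih.eventuallyEq_of_mem (hU.mem_nhds ht)).fderiv_eq (𝕜 := ℝ)
    simp only [iterPartial, this]
  | trans _ _ ih1 ih2 => exact ih1.trans ih2
  | swap i j L =>
    intro t ht
    have hs := iterPartial_smooth hU hf L
    have hat : ContDiffAt ℝ ∞ (iterPartial L f) t := (hs t ht).contDiffAt (hU.mem_nhds ht)
    have hsym : IsSymmSndFDerivAt ℝ (iterPartial L f) t :=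
      hat.isSymmSndFDerivAt (by
        rw [minSmoothness_of_isRCLikeNormedField]
        exact WithTop.coe_le_coe.2 (le_top : (2 : ℕ∞) ≤ ⊤))
    have hd : DifferentiableAt ℝ (fderiv ℝ (iterPartial L f)) t :=
      (hat.fderiv_right (m := ∞) (by simp)).differentiableAt (by simp)
    have key (v : EuclideanSpace ℝ (Fin n)) :
        fderiv ℝ (fun t ↦ fderiv ℝ (iterPartial L f) t v) t =
          (fderiv ℝ (fderiv ℝ (iterPartial L f)) t).flip v := by
      rw [fderiv_clm_apply hd (differentiableAt_const v)]; simp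
    simp only [iterPartial, key, ContinuousLinearMap.flip_apply]
    exact hsym _ _

theorem iterPartial_eq_iteratedFDeriv {U : Set (EuclideanSpace ℝ (Fin n))} (hU : IsOpen U)
    {f : EuclideanSpace ℝ (Fin n) → ℝ} (hf : ContDiffOn ℝ ∞ f U) (L : List (Fin n)) :
    Set.EqOn (iterPartial L f) (fun t ↦ iteratedFDeriv ℝ L.length f t
      (fun i ↦ EuclideanSpace.single (L.get i) (1 : ℝ))) U := by
  induction L with
  | nil => intro t _; simp [iterPartial]
  | cons i L ih =>
    intro t ht
    have h1 := (ih.eventuallyEq_of_mem (hU.mem_nhds ht)).fderiv_eq (𝕜 := ℝ)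
    have hd : DifferentiableAt ℝ (iteratedFDeriv ℝ L.length f) t :=
      (((hf t ht).contDiffAt (hU.mem_nhds ht)).iteratedFDeriv_right (m := ∞)
        (by exact_mod_cast le_top)).differentiableAt (by simp)
    simp only [iterPartial, h1]
    exact (fderiv_continuousMultilinear_apply_const_apply hd _ _).trans
      (iteratedFDeriv_succ_apply_left (𝕜 := ℝ) (f := f) (x := t)
        (fun l ↦ EuclideanSpace.single ((i :: L).get l) (1 : ℝ))).symm


variable {N r : ℕ}

/-- The `r`-jet at `0` in coordinates: the partial derivatives of order `≤ r` of the components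
of `f : ℝⁿ → ℝᴺ` at `0`. (For functions that are smooth near `0` the order of the indices within
the multi-index is irrelevant, see `iterPartial_perm`.) -/
noncomputable def jet (r : ℕ) (f : EuclideanSpace ℝ (Fin n) → EuclideanSpace ℝ (Fin N)) :
    JetCoord N n r :=
  fun A J ↦ iterPartial J.1.toList (fun t ↦ f t A) 0

theorem jet_eq_iff_list {U : Set (EuclideanSpace ℝ (Fin n))} (hU : IsOpen U) (h0 : 0 ∈ U)
    {f g : EuclideanSpace ℝ (Fin n) → EuclideanSpace ℝ (Fin N)} (hf : ContDiffOn ℝ ∞ f U)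
    (hg : ContDiffOn ℝ ∞ g U) (h : jet r f = jet r g) (A : Fin N) (L : List (Fin n))
    (hL : L.length ≤ r) :
    iterPartial L (fun t ↦ f t A) 0 = iterPartial L (fun t ↦ g t A) 0 := by
  have hp : L.Perm (L : Multiset (Fin n)).toList := by
    rw [← Multiset.coe_eq_coe, Multiset.coe_toList]
  have hfA : ContDiffOn ℝ ∞ (fun t ↦ f t A) U :=
    (coordProj N A).contDiff.comp_contDiffOn hf
  have hgA : ContDiffOn ℝ ∞ (fun t ↦ g t A) U :=
    (coordProj N A).contDiff.comp_contDiffOn hg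
  rw [iterPartial_perm hU hfA hp h0, iterPartial_perm hU hgA hp h0]
  exact congrFun (congrFun h A) ⟨(L : Multiset (Fin n)), by rw [Multiset.coe_card]; exact hL⟩

theorem iteratedFDeriv_eq_of_jet_eq {U : Set (EuclideanSpace ℝ (Fin n))} (hU : IsOpen U)
    (h0 : 0 ∈ U)
    {f g : EuclideanSpace ℝ (Fin n) → EuclideanSpace ℝ (Fin N)} (hf : ContDiffOn ℝ ∞ f U)
    (hg : ContDiffOn ℝ ∞ g U) (h : jet r f = jet r g) (k : ℕ) (hk : k ≤ r) :
    iteratedFDeriv ℝ k f 0 = iteratedFDeriv ℝ k g 0 := by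
  have comp (f : EuclideanSpace ℝ (Fin n) → EuclideanSpace ℝ (Fin N)) (hf : ContDiffOn ℝ ∞ f U)
      (v : Fin k → Fin n) (A : Fin N) :
      iteratedFDeriv ℝ k f 0 (fun i ↦ EuclideanSpace.single (v i) (1 : ℝ)) A =
        iterPartial (List.ofFn v) (fun t ↦ f t A) 0 := by
    have hfA : ContDiffOn ℝ ∞ (fun t ↦ f t A) U :=
      (coordProj N A).contDiff.comp_contDiffOn hf
    rw [iterPartial_eq_iteratedFDeriv hU hfA _ h0]
    have h1 := (coordProj N A).iteratedFDeriv_comp_left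
      ((hf 0 h0).contDiffAt (hU.mem_nhds h0)) (i := k) (by exact_mod_cast le_top)
    have h2 := congrArg (fun m ↦ m (fun i ↦ EuclideanSpace.single (v i) (1 : ℝ))) h1
    have h3 : ∀ (l : ℕ) (hl : l = k) (w : Fin l → EuclideanSpace ℝ (Fin n)),
        (∀ i, w i = EuclideanSpace.single (v (Fin.cast hl i)) (1 : ℝ)) →
        iteratedFDeriv ℝ l (fun t ↦ f t A) 0 w =
        iteratedFDeriv ℝ k (fun t ↦ f t A) 0 (fun i ↦ EuclideanSpace.single (v i) (1 : ℝ)) := by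
      intro l hl w hw
      subst hl
      congr 1
      ext1 i; exact hw i
    simp only
    rw [h3 _ (List.length_ofFn (f := v)) _ (by intro i; simp [Fin.cast])]
    exact h2.symm
  apply ContinuousMultilinearMap.toMultilinearMap_injective
  refine Module.Basis.ext_multilinear
    (fun _ ↦ (EuclideanSpace.basisFun (Fin n) ℝ).toBasis) fun v ↦ ?_
  ext A
  simp only [OrthonormalBasis.coe_toBasis, EuclideanSpace.basisFun_apply,
    ContinuousMultilinearMap.coe_coe]
  rw [comp f hf, comp g hg]
  exact jet_eq_iff_list hU h0 hf hg h A _ (by simpa using hk)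

theorem iterPartial_comp_eq_of_jet_eq {U : Set (EuclideanSpace ℝ (Fin n))} (hU : IsOpen U)
    (h0 : 0 ∈ U)
    {f g : EuclideanSpace ℝ (Fin n) → EuclideanSpace ℝ (Fin N)} (hf : ContDiffOn ℝ ∞ f U)
    (hg : ContDiffOn ℝ ∞ g U) (h : jet r f = jet r g)
    {V : Set (EuclideanSpace ℝ (Fin N))} (hV : IsOpen V) (hfV : f 0 ∈ V)
    {F : EuclideanSpace ℝ (Fin N) → ℝ} (hF : ContDiffOn ℝ ∞ F V) (L : List (Fin n))
    (hL : L.length ≤ r) :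
    iterPartial L (F ∘ f) 0 = iterPartial L (F ∘ g) 0 := by
  have hfg : f 0 = g 0 := by
    ext A
    simpa [iterPartial] using jet_eq_iff_list hU h0 hf hg h A [] (by simp)
  have aux (f : EuclideanSpace ℝ (Fin n) → EuclideanSpace ℝ (Fin N)) (hf : ContDiffOn ℝ ∞ f U)
      (hfV : f 0 ∈ V) : iterPartial L (F ∘ f) 0 =
        (ftaylorSeries ℝ F (f 0)).taylorComp (ftaylorSeries ℝ f 0) L.length
          (fun i ↦ EuclideanSpace.single (L.get i) (1 : ℝ)) := by
    have hW : IsOpen (U ∩ f ⁻¹' V) := hf.continuousOn.isOpen_inter_preimage hU hV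
    have hFf : ContDiffOn ℝ ∞ (F ∘ f) (U ∩ f ⁻¹' V) :=
      hF.comp (hf.mono Set.inter_subset_left) fun t ht ↦ ht.2
    rw [iterPartial_eq_iteratedFDeriv hW hFf L ⟨h0, hfV⟩]
    simp only
    rw [iteratedFDeriv_comp (n := ∞) ((hF _ hfV).contDiffAt (hV.mem_nhds hfV))
      ((hf 0 h0).contDiffAt (hU.mem_nhds h0)) (by exact_mod_cast le_top)]
  rw [aux f hf hfV, aux g hg (hfg ▸ hfV)]
  congr 1
  simp only [FormalMultilinearSeries.taylorComp, hfg]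
  refine Finset.sum_congr rfl fun c _ ↦ ?_
  simp only [FormalMultilinearSeries.compAlongOrderedFinpartition]
  congr 1
  funext m
  exact iteratedFDeriv_eq_of_jet_eq hU h0 hf hg h _ ((c.partSize_le m).trans hL)

/-- The polynomial map `ℝⁿ → ℝᴺ` with prescribed partial derivatives `y^A_J` at `0`. -/
noncomputable def taylorPoly (y : JetCoord N n r) (t : EuclideanSpace ℝ (Fin n)) :
    EuclideanSpace ℝ (Fin N) :=
  WithLp.toLp 2 fun A ↦ ∑ k : Fin (r + 1), ((k : ℕ)! : ℝ)⁻¹ * ∑ j : Fin k → Fin n,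
    y A ⟨(List.ofFn j : Multiset (Fin n)), by
      rw [Multiset.coe_card, List.length_ofFn]; exact Nat.le_of_lt_succ k.2⟩ * ∏ i, t (j i)

/-- The components `(y^A)` of order zero. -/
noncomputable def jetBase (y : JetCoord N n r) : EuclideanSpace ℝ (Fin N) :=
  WithLp.toLp 2 fun A ↦ y A ⟨0, Nat.zero_le r⟩

theorem continuous_jetBase : Continuous (jetBase : JetCoord N n r → _) :=
  (PiLp.continuous_toLp 2 _).comp (by fun_prop)

theorem jetBase_jet (f : EuclideanSpace ℝ (Fin n) → EuclideanSpace ℝ (Fin N)) :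
    jetBase (jet r f) = f 0 := by
  ext A
  simp [jetBase, jet, iterPartial]

theorem taylorPoly_contDiff :
    ContDiff ℝ ∞ (fun q : JetCoord N n r × EuclideanSpace ℝ (Fin n) ↦ taylorPoly q.1 q.2) := by
  unfold taylorPoly
  refine (PiLp.contDiff_toLp).comp (contDiff_pi.2 fun A ↦ ?_)
  refine ContDiff.sum fun k _ ↦ contDiff_const.mul (ContDiff.sum fun j _ ↦ ?_)
  refine ContDiff.mul ?_ (contDiff_prod fun i _ ↦ ?_)
  · fun_prop
  · exact (coordProj n (j i)).contDiff.comp contDiff_snd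

theorem iterPartial_taylorPoly (y : JetCoord N n r) (A : Fin N) (L : List (Fin n))
    (hL : L.length ≤ r) : iterPartial L (fun t ↦ taylorPoly y t A) 0 =
      y A ⟨(L : Multiset (Fin n)), by rw [Multiset.coe_card]; exact hL⟩ := by
  classical
  have hs : ContDiffOn ℝ ∞ (fun t ↦ taylorPoly y t A) Set.univ :=
    ((coordProj N A).contDiff.comp
      (taylorPoly_contDiff.comp (contDiff_const.prodMk contDiff_id))).contDiffOn
  rw [iterPartial_eq_iteratedFDeriv isOpen_univ hs L (Set.mem_univ _)]
  let p : FormalMultilinearSeries ℝ (EuclideanSpace ℝ (Fin n)) ℝ := fun k ↦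
    if hk : k < r + 1 then ((k : ℕ)! : ℝ)⁻¹ • ∑ j : Fin k → Fin n,
      y A ⟨(List.ofFn j : Multiset (Fin n)), by
        rw [Multiset.coe_card, List.length_ofFn]; exact Nat.le_of_lt_succ hk⟩ •
        (ContinuousMultilinearMap.mkPiAlgebra ℝ (Fin k) ℝ).compContinuousLinearMap
          (fun i ↦ coordProj n (j i))
    else 0
  have hp0 : ∀ m, p (m + (r + 1)) = 0 := fun m ↦ by
    have : ¬ m + (r + 1) < r + 1 := by omega
    simp only [p, this, dite_false]
  have hball : HasFPowerSeriesOnBall (fun t ↦ taylorPoly y t A) p 0 ⊤ := by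
    have h1 := p.hasFPowerSeriesOnBall (by
      rw [p.radius_eq_top_of_forall_image_add_eq_zero _ hp0]; exact ENNReal.coe_lt_top)
    rw [p.radius_eq_top_of_forall_image_add_eq_zero _ hp0] at h1
    convert h1 using 1
    funext t
    rw [FormalMultilinearSeries.sum, tsum_eq_sum (s := Finset.range (r + 1)), 
      Finset.sum_range]
    · simp only [taylorPoly, p]
      refine Finset.sum_congr rfl fun k _ ↦ ?_
      rw [dif_pos k.2]
      simp
    · intro k hk
      have : ¬ k < r + 1 := by simpa using hk
      simp only [p, this, dite_false, zero_apply]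
  simp only
  rw [hball.iteratedFDeriv_eq_sum_of_completeSpace]
  have hlt : L.length < r + 1 := Nat.lt_succ_of_le hL
  have key (σ : Equiv.Perm (Fin L.length)) :
      p L.length (fun i ↦ EuclideanSpace.single (L.get (σ i)) (1 : ℝ)) =
      ((L.length)! : ℝ)⁻¹ * y A ⟨(L : Multiset (Fin n)), by rw [Multiset.coe_card]; exact hL⟩ := by
    simp only [p, hlt, dite_true, smul_apply,
      sum_apply, smul_eq_mul,
      ContinuousMultilinearMap.compContinuousLinearMap_apply,
      ContinuousMultilinearMap.mkPiAlgebra_apply]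
    congr 1
    rw [Finset.sum_eq_single (fun i ↦ L.get (σ i))]
    · have : (List.ofFn (fun i ↦ L.get (σ i)) : Multiset (Fin n)) = L := by
        rw [Multiset.coe_eq_coe]
        have := Equiv.Perm.ofFn_comp_perm σ L.get
        rw [List.ofFn_get] at this
        exact this
      simp only [List.get_eq_getElem] at this
      simp [this]
    · intro j _ hj
      obtain ⟨i, hi⟩ := Function.ne_iff.1 hj
      rw [Finset.prod_eq_zero (Finset.mem_univ i), mul_zero]
      simp
      exact hi
    · simp
  simp only [key, Finset.sum_const, Finset.card_univ, Fintype.card_perm, Fintype.card_fin,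
    nsmul_eq_mul]
  rw [← mul_assoc, mul_inv_cancel₀ (by positivity), one_mul]

theorem jet_taylorPoly (y : JetCoord N n r) : jet r (taylorPoly y) = y := by
  funext A J
  have := iterPartial_taylorPoly y A J.1.toList (by simpa using J.2)
  simp only [Multiset.coe_toList] at this
  exact this

theorem taylorPoly_zero (y : JetCoord N n r) : taylorPoly y 0 = jetBase y := by
  conv_rhs => rw [← jet_taylorPoly y, jetBase_jet]

theorem taylorPoly_contDiff_right (y : JetCoord N n r) : ContDiff ℝ ∞ (taylorPoly (N := N) y) :=
  taylorPoly_contDiff.comp (contDiff_const.prodMk contDiff_id)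

end partials

section velocities

variable (N n r : ℕ) (X : Type*) [TopologicalSpace X]
  [ChartedSpace (EuclideanSpace ℝ (Fin N)) X] [IsManifold (𝓡 N) ∞ X]

/-- The charts of the smooth manifold `X`, i.e. the elements of its maximal smooth atlas. -/
abbrev Chart : Type _ := IsManifold.maximalAtlas (𝓡 N) ∞ X

/-- Representatives of velocities: maps into `X` that are smooth on a neighbourhood of `0 ∈ ℝⁿ`. -/
def Germ (N n : ℕ) (X : Type*) [TopologicalSpace X]
    [ChartedSpace (EuclideanSpace ℝ (Fin N)) X] : Type _ :=
  {γ : EuclideanSpace ℝ (Fin n) → X // ∃ U : Set (EuclideanSpace ℝ (Fin n)),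
    IsOpen U ∧ 0 ∈ U ∧ ContMDiffOn (𝓡 n) (𝓡 N) ∞ γ U}

variable {N n r X}

theorem Germ.exists_local (γ : Germ N n X) (e : Chart N X) (h : γ.1 0 ∈ e.1.source) :
    ∃ U : Set (EuclideanSpace ℝ (Fin n)), IsOpen U ∧ 0 ∈ U ∧ Set.MapsTo γ.1 U e.1.source ∧
      ContDiffOn ℝ ∞ (e.1 ∘ γ.1) U := by
  obtain ⟨U, hU, h0, hγ⟩ := γ.2
  refine ⟨U ∩ γ.1 ⁻¹' e.1.source, hγ.continuousOn.isOpen_inter_preimage hU e.1.open_source,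
    ⟨h0, h⟩, fun t ht ↦ ht.2, ?_⟩
  rw [← contMDiffOn_iff_contDiffOn]
  exact (contMDiffOn_of_mem_maximalAtlas e.2).comp (hγ.mono Set.inter_subset_left) fun t ht ↦ ht.2

/-- Two maps `γ`, `δ` with `γ 0 = δ 0` are equivalent if, in some chart of `X` around this point,
they have the same partial derivatives up to order `r` at `0`. -/
def Germ.Rel (r : ℕ) (γ δ : Germ N n X) : Prop :=
  γ.1 0 = δ.1 0 ∧ ∃ e : Chart N X, γ.1 0 ∈ e.1.source ∧ jet r (e.1 ∘ γ.1) = jet r (e.1 ∘ δ.1)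

theorem Chart.contDiffOn_trans (e e' : Chart N X) :
    ContDiffOn ℝ ∞ (e'.1 ∘ e.1.symm) (e.1.target ∩ e.1.symm ⁻¹' e'.1.source) := by
  rw [← contMDiffOn_iff_contDiffOn]
  exact (contMDiffOn_of_mem_maximalAtlas e'.2).comp
    ((contMDiffOn_symm_of_mem_maximalAtlas e.2).mono Set.inter_subset_left) fun t ht ↦ ht.2

theorem Germ.Rel.jet_eq {γ δ : Germ N n X} (h : γ.Rel r δ) (e' : Chart N X)
    (he' : γ.1 0 ∈ e'.1.source) : jet r (e'.1 ∘ γ.1) = jet r (e'.1 ∘ δ.1) := by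
  obtain ⟨h0, e, he, hj⟩ := h
  obtain ⟨U, hU, hU0, hUe, hγ⟩ := γ.exists_local e he
  obtain ⟨V, hV, hV0, hVe, hδ⟩ := δ.exists_local e (h0 ▸ he)
  have hT : IsOpen (e.1.target ∩ e.1.symm ⁻¹' e'.1.source) :=
    e.1.isOpen_inter_preimage_symm e'.1.open_source
  have hmem : e.1 (γ.1 0) ∈ e.1.target ∩ e.1.symm ⁻¹' e'.1.source :=
    ⟨e.1.map_source he, by simpa [he] using he'⟩
  funext A J
  have hF : ContDiffOn ℝ ∞ (fun z ↦ (e'.1 ∘ e.1.symm) z A)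
      (e.1.target ∩ e.1.symm ⁻¹' e'.1.source) :=
    (coordProj N A).contDiff.comp_contDiffOn (e.contDiffOn_trans e')
  have key := iterPartial_comp_eq_of_jet_eq (hU.inter hV) ⟨hU0, hV0⟩
    (hγ.mono Set.inter_subset_left) (hδ.mono Set.inter_subset_right) hj hT hmem hF J.1.toList
    (by rw [Multiset.length_toList]; exact J.2)
  have h1 := iterPartial_congr (n := n) hU (f := fun t ↦ (e'.1 ∘ γ.1) t A)
    (g := (fun z ↦ (e'.1 ∘ e.1.symm) z A) ∘ (e.1 ∘ γ.1))
    (fun t ht ↦ by simp [e.1.left_inv (hUe ht)]) J.1.toList hU0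
  have h2 := iterPartial_congr (n := n) hV (f := fun t ↦ (e'.1 ∘ δ.1) t A)
    (g := (fun z ↦ (e'.1 ∘ e.1.symm) z A) ∘ (e.1 ∘ δ.1))
    (fun t ht ↦ by simp [e.1.left_inv (hVe ht)]) J.1.toList hV0
  exact h1.trans (key.trans h2.symm)

theorem exists_chart (x : X) : ∃ e : Chart N X, x ∈ e.1.source :=
  ⟨⟨chartAt _ x, IsManifold.chart_mem_maximalAtlas x⟩, mem_chart_source _ x⟩

/-- The equivalence relation that defines the `(r, n)`-velocities. -/
def Germ.setoid (r N n : ℕ) (X : Type*) [TopologicalSpace X]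
    [ChartedSpace (EuclideanSpace ℝ (Fin N)) X] [IsManifold (𝓡 N) ∞ X] :
    Setoid (Germ N n X) where
  r := Germ.Rel r
  iseqv := by
    refine ⟨fun γ ↦ ?_, ?_, ?_⟩
    · obtain ⟨e, he⟩ := exists_chart (N := N) (γ.1 0)
      exact ⟨rfl, e, he, rfl⟩
    · rintro γ δ ⟨h0, e, he, hj⟩
      exact ⟨h0.symm, e, h0 ▸ he, hj.symm⟩
    · rintro γ δ ε ⟨h0, e, he, hj⟩ h2
      exact ⟨h0.trans h2.1, e, he, hj.trans (Germ.Rel.jet_eq h2 e (h0 ▸ he))⟩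

/-- The set `T^r_n X` of `(r, n)`-velocities of the `N`-dimensional manifold `X`: the `r`-jets at
`0` of smooth maps from neighbourhoods of `0 ∈ ℝⁿ` to `X`. -/
def Velocity (r N n : ℕ) (X : Type*) [TopologicalSpace X]
    [ChartedSpace (EuclideanSpace ℝ (Fin N)) X] [IsManifold (𝓡 N) ∞ X] : Type _ :=
  Quotient (Germ.setoid r N n X)

/-- The projection `T^r_n X → X`, `j^r_0 γ ↦ γ 0`. -/
def Velocity.base (v : Velocity r N n X) : X :=
  Quotient.lift (fun γ : Germ N n X ↦ γ.1 0) (fun γ δ (h : Germ.Rel r γ δ) ↦ h.1) v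

/-- The velocity `j^r_0 γ`. -/
def Germ.vel (r : ℕ) (γ : Germ N n X) : Velocity r N n X := Quotient.mk (Germ.setoid r N n X) γ

theorem Germ.vel_base (γ : Germ N n X) : (γ.vel r).base = γ.1 0 := rfl

open Classical in
/-- The map `t ↦ ψ⁻¹ (P_y t)`, where `P_y` is the polynomial with derivatives `y` at `0`
(with a dummy value if this is not defined near `0`). -/
noncomputable def Chart.taylorGerm (e : Chart N X) (y : JetCoord N n r) : Germ N n X :=
  if h : jetBase y ∈ e.1.target then
    ⟨fun t ↦ e.1.symm (taylorPoly y t),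
      taylorPoly y ⁻¹' e.1.target,
      e.1.open_target.preimage (taylorPoly_contDiff_right y).continuous,
      by rw [Set.mem_preimage, taylorPoly_zero]; exact h,
      (contMDiffOn_symm_of_mem_maximalAtlas e.2).comp
        (taylorPoly_contDiff_right y).contMDiff.contMDiffOn fun _ ht ↦ ht⟩
  else ⟨fun _ ↦ e.1.symm 0, Set.univ, isOpen_univ, Set.mem_univ _, contMDiffOn_const⟩

theorem Chart.taylorGerm_apply (e : Chart N X) {y : JetCoord N n r}
    (h : jetBase y ∈ e.1.target) :
    (e.taylorGerm y).1 = fun t ↦ e.1.symm (taylorPoly y t) := by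
  simp [Chart.taylorGerm, h]

/-- The coordinates `x^A_J (j^r_0 γ) = ∂_J (x^A ∘ γ) (0)` of a velocity in the chart associated
to a chart `(V, ψ = (x^A))` of `X`; see `Chart.coords_vel`. -/
noncomputable def Chart.coords (e : Chart N X) (v : Velocity r N n X) : JetCoord N n r :=
  jet r (e.1 ∘ (Quotient.out v).1)

theorem Chart.coords_vel (e : Chart N X) (γ : Germ N n X) (h : γ.1 0 ∈ e.1.source) :
    e.coords (γ.vel r) = jet r (e.1 ∘ γ.1) := by
  have h1 : Germ.Rel r (Quotient.out (γ.vel r)) γ := Quotient.mk_out (s := Germ.setoid r N n X) γ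
  exact h1.jet_eq e (h1.1 ▸ h)

theorem Chart.jet_taylorGerm (e e' : Chart N X) {y : JetCoord N n r}
    (h : jetBase y ∈ e.1.target) : jet r (e'.1 ∘ (e.taylorGerm y).1) =
      jet r (fun t ↦ (e'.1 ∘ e.1.symm) (taylorPoly y t)) := by
  rw [e.taylorGerm_apply h]; rfl

theorem Chart.jet_taylorGerm_self (e : Chart N X) {y : JetCoord N n r}
    (h : jetBase y ∈ e.1.target) : jet r (e.1 ∘ (e.taylorGerm y).1) = y := by
  conv_rhs => rw [← jet_taylorPoly y]
  rw [e.taylorGerm_apply h]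
  have hU : IsOpen (taylorPoly y ⁻¹' e.1.target) :=
    e.1.open_target.preimage (taylorPoly_contDiff_right y).continuous
  funext A J
  refine iterPartial_congr hU (fun t ht ↦ ?_) _ (show taylorPoly y 0 ∈ _ by rwa [taylorPoly_zero])
  simp only [Function.comp]
  rw [e.1.right_inv ht]

theorem Chart.taylorGerm_zero (e : Chart N X) {y : JetCoord N n r}
    (h : jetBase y ∈ e.1.target) : (e.taylorGerm y).1 0 = e.1.symm (jetBase y) := by
  rw [e.taylorGerm_apply h]
  exact congrArg e.1.symm (taylorPoly_zero y)

/-- The chart `(V^r, ψ^r)` of `T^r_n X` associated to the chart `(V, ψ)` of `X`, as a bijection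
from the set of velocities at points of `V` onto a subset of the coordinate space. -/
noncomputable def Chart.assoc (r n : ℕ) (e : Chart N X) :
    PartialEquiv (Velocity r N n X) (JetCoord N n r) where
  toFun v := e.coords v
  invFun y := (e.taylorGerm y).vel r
  source := {v | v.base ∈ e.1.source}
  target := {y | jetBase y ∈ e.1.target}
  map_source' v hv := by
    induction v using Quotient.inductionOn with | _ γ => ?_
    have := e.coords_vel (r := r) γ hv
    change jetBase (e.coords (γ.vel r)) ∈ e.1.target
    rw [this, jetBase_jet]
    exact e.1.map_source hv
  map_target' y hy := by
    change (e.taylorGerm y).1 0 ∈ e.1.source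
    rw [e.taylorGerm_zero hy]
    exact e.1.map_target hy
  left_inv' v hv := by
    induction v using Quotient.inductionOn with | _ γ => ?_
    change (e.taylorGerm (e.coords (γ.vel r))).vel r = γ.vel r
    rw [e.coords_vel γ hv]
    have hb : jetBase (jet r (e.1 ∘ γ.1)) ∈ e.1.target := by
      rw [jetBase_jet]; exact e.1.map_source hv
    have h0 : (e.taylorGerm (jet r (e.1 ∘ γ.1))).1 0 = γ.1 0 := by
      rw [e.taylorGerm_zero hb, jetBase_jet]; exact e.1.left_inv hv
    exact Quotient.sound (s := Germ.setoid r N n X)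
      ⟨h0, e, h0 ▸ hv, e.jet_taylorGerm_self hb⟩
  right_inv' y hy := by
    rw [e.coords_vel, e.jet_taylorGerm_self hy]
    rw [e.taylorGerm_zero hy]
    exact e.1.map_target hy

theorem Chart.assoc_trans_source (r n : ℕ) (e e' : Chart N X) :
    ((e.assoc r n).symm.trans (e'.assoc r n)).source =
      jetBase ⁻¹' (e.1.target ∩ e.1.symm ⁻¹' e'.1.source) := by
  ext y
  simp only [PartialEquiv.trans_source, PartialEquiv.symm_source, Set.mem_inter_iff,
    Set.mem_preimage]
  refine and_congr_right fun hy ↦ ?_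
  change (e.taylorGerm y).1 0 ∈ e'.1.source ↔ e.1.symm (jetBase y) ∈ e'.1.source
  rw [e.taylorGerm_zero hy]

theorem contDiffOn_jet_comp (e e' : Chart N X) :
    ContDiffOn ℝ ∞ (fun y : JetCoord N n r ↦ jet r (fun t ↦ (e'.1 ∘ e.1.symm) (taylorPoly y t)))
      (jetBase ⁻¹' (e.1.target ∩ e.1.symm ⁻¹' e'.1.source)) := by
  have hT : IsOpen (e.1.target ∩ e.1.symm ⁻¹' e'.1.source) :=
    e.1.isOpen_inter_preimage_symm e'.1.open_source
  let U : Set (JetCoord N n r × EuclideanSpace ℝ (Fin n)) :=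
    (fun q ↦ taylorPoly q.1 q.2) ⁻¹' (e.1.target ∩ e.1.symm ⁻¹' e'.1.source)
  have hU : IsOpen U := hT.preimage taylorPoly_contDiff.continuous
  have h1 : ContDiffOn ℝ ∞ (fun q : JetCoord N n r × EuclideanSpace ℝ (Fin n) ↦
      (e'.1 ∘ e.1.symm) (taylorPoly q.1 q.2)) U :=
    ContDiffOn.comp (g := e'.1 ∘ e.1.symm)
      (f := fun q : JetCoord N n r × EuclideanSpace ℝ (Fin n) ↦ taylorPoly q.1 q.2)
      (e.contDiffOn_trans e') taylorPoly_contDiff.contDiffOn fun q hq ↦ hq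
  have hi : ContDiffOn ℝ ∞ (fun y : JetCoord N n r ↦ (y, (0 : EuclideanSpace ℝ (Fin n))))
      (jetBase ⁻¹' (e.1.target ∩ e.1.symm ⁻¹' e'.1.source)) :=
    (contDiff_id.prodMk contDiff_const).contDiffOn
  have hm : Set.MapsTo (fun y : JetCoord N n r ↦ (y, (0 : EuclideanSpace ℝ (Fin n))))
      (jetBase ⁻¹' (e.1.target ∩ e.1.symm ⁻¹' e'.1.source)) U := by
    intro y hy
    change taylorPoly y 0 ∈ e.1.target ∩ e.1.symm ⁻¹' e'.1.source
    rw [taylorPoly_zero]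
    exact hy
  rw [contDiffOn_pi]
  intro A
  rw [contDiffOn_pi]
  intro J
  have hg : ContDiffOn ℝ ∞
      (fun q : JetCoord N n r × EuclideanSpace ℝ (Fin n) ↦
        (e'.1 ∘ e.1.symm) (taylorPoly q.1 q.2) A) U :=
    (coordProj N A).contDiff.comp_contDiffOn h1
  have h2 := iterPartial_contDiffOn hU hg J.1.toList
  have h3 := h2.comp hi hm
  exact h3

theorem Chart.assoc_trans_contDiffOn (r n : ℕ) (e e' : Chart N X) :
    ContDiffOn ℝ ∞ ((e.assoc r n).symm.trans (e'.assoc r n))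
      ((e.assoc r n).symm.trans (e'.assoc r n)).source := by
  rw [e.assoc_trans_source]
  have hT : IsOpen (e.1.target ∩ e.1.symm ⁻¹' e'.1.source) :=
    e.1.isOpen_inter_preimage_symm e'.1.open_source
  have heq : Set.EqOn ((e.assoc r n).symm.trans (e'.assoc r n))
      (fun y ↦ jet r (fun t ↦ (e'.1 ∘ e.1.symm) (taylorPoly y t)))
      (jetBase ⁻¹' (e.1.target ∩ e.1.symm ⁻¹' e'.1.source)) := by
    intro y hy
    change e'.coords ((e.taylorGerm y).vel r) = _
    rw [e'.coords_vel, e.jet_taylorGerm e' hy.1]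
    rw [e.taylorGerm_zero hy.1]
    exact hy.2
  refine ContDiffOn.congr (contDiffOn_jet_comp e e') heq

/-- The smooth structure of `T^r_n X`: the atlas of all associated charts. -/
noncomputable def velocityCore (r N n : ℕ) (X : Type*) [TopologicalSpace X]
    [ChartedSpace (EuclideanSpace ℝ (Fin N)) X] [IsManifold (𝓡 N) ∞ X] :
    ChartedSpaceCore (JetCoord N n r) (Velocity r N n X) where
  atlas := Set.range (Chart.assoc r n)
  chartAt v := (exists_chart (N := N) v.base).choose.assoc r n
  mem_chart_source v := (exists_chart (N := N) v.base).choose_spec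
  chart_mem_atlas v := ⟨_, rfl⟩
  open_source := by
    rintro _ _ ⟨e, rfl⟩ ⟨e', rfl⟩
    rw [e.assoc_trans_source]
    exact (e.1.isOpen_inter_preimage_symm e'.1.open_source).preimage continuous_jetBase
  continuousOn_toFun := by
    rintro _ _ ⟨e, rfl⟩ ⟨e', rfl⟩
    exact (e.assoc_trans_contDiffOn r n e').continuousOn

noncomputable instance : TopologicalSpace (Velocity r N n X) :=
  (velocityCore r N n X).toTopologicalSpace

noncomputable instance : ChartedSpace (JetCoord N n r) (Velocity r N n X) :=
  (velocityCore r N n X).toChartedSpace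

/-- The chart `(V^r, ψ^r)` of the manifold `T^r_n X` associated to the chart `(V, ψ)` of `X`. -/
noncomputable def Chart.velocityChart (r n : ℕ) (e : Chart N X) :
    OpenPartialHomeomorph (Velocity r N n X) (JetCoord N n r) :=
  (velocityCore r N n X).openPartialHomeomorph (e.assoc r n) ⟨e, rfl⟩

theorem mem_atlas_velocity (f : OpenPartialHomeomorph (Velocity r N n X) (JetCoord N n r)) :
    f ∈ atlas (JetCoord N n r) (Velocity r N n X) ↔ ∃ e : Chart N X, f = e.velocityChart r n := by
  constructor
  · intro h
    obtain ⟨_, ⟨e, rfl⟩, h⟩ := Set.mem_iUnion₂.1 h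
    exact ⟨e, h⟩
  · rintro ⟨e, rfl⟩
    exact Set.mem_iUnion₂.2 ⟨_, ⟨e, rfl⟩, rfl⟩

instance : IsManifold 𝓘(ℝ, JetCoord N n r) ∞ (Velocity r N n X) := by
  refine isManifold_of_contDiffOn _ _ _ fun f f' hf hf' ↦ ?_
  obtain ⟨e, rfl⟩ := (mem_atlas_velocity f).1 hf
  obtain ⟨e', rfl⟩ := (mem_atlas_velocity f').1 hf'
  have := e.assoc_trans_contDiffOn r n e'
  simpa using! this

theorem jet_mono {s t : ℕ} (h : s ≤ t) {f g : EuclideanSpace ℝ (Fin n) → EuclideanSpace ℝ (Fin N)}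
    (hfg : jet t f = jet t g) : jet s f = jet s g := by
  funext A J
  exact congrFun (congrFun hfg A) ⟨J.1, J.2.trans h⟩

/-- The canonical projection `τ^{t,s} : T^t_n X → T^s_n X`, `j^t_0 γ ↦ j^s_0 γ`, for `s ≤ t`. -/
def Velocity.proj {s t : ℕ} (h : s ≤ t) (v : Velocity t N n X) : Velocity s N n X :=
  Quotient.lift (fun γ : Germ N n X ↦ γ.vel s)
    (fun γ δ (hr : Germ.Rel t γ δ) ↦ Quotient.sound (s := Germ.setoid s N n X)
      ⟨hr.1, hr.2.choose, hr.2.choose_spec.1, jet_mono h hr.2.choose_spec.2⟩) v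

end velocities

section formal

variable {N n r : ℕ}

/-- The coordinate function `x^A_J` (zero if `|J| > r`). -/
def jetEntry (A : Fin N) (J : Multiset (Fin n)) (y : JetCoord N n r) : ℝ :=
  if h : Multiset.card J ≤ r then y A ⟨J, h⟩ else 0

/-- The operator `∂^J_A = (r₁! ⋯ r_n! / k!) ∂/∂x^A_J` with `k = |J|` and `r_i` the multiplicity of
the index `i` in `J` (zero if `|J| > r`). -/
noncomputable def weightedPartial (A : Fin N) (J : Multiset (Fin n)) (f : JetCoord N n r → ℝ) :
    JetCoord N n r → ℝ := fun y ↦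
  if h : Multiset.card J ≤ r then
    ((∏ i, ((J.count i)! : ℝ)) / ((Multiset.card J)! : ℝ)) *
      fderiv ℝ f y (Pi.single A (Pi.single ⟨J, h⟩ 1))
  else 0

/-- The multi-index `{j₁, …, j_k}` of a `k`-tuple. Sums over multi-indices of length `k` are sums
over all `k`-tuples of indices; the weights in `weightedPartial` take care of the overcounting. -/
def tupleIndex {k : ℕ} (j : Fin k → Fin n) : Multiset (Fin n) := (List.ofFn j : Multiset (Fin n))

/-- The formal derivative `d_i = ∑_{|J| ≤ r - 1} x^A_{iJ} ∂^J_A`. -/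
noncomputable def formalDeriv (i : Fin n) (f : JetCoord N n r → ℝ) : JetCoord N n r → ℝ := fun y ↦
  ∑ k ∈ Finset.range r, ∑ j : Fin k → Fin n, ∑ A : Fin N,
    jetEntry A (i ::ₘ tupleIndex j) y * weightedPartial A (tupleIndex j) f y

/-- The iterated formal derivative `d_{j₁} ⋯ d_{j_k}`. -/
noncomputable def iterFormalDeriv (L : List (Fin n)) (f : JetCoord N n r → ℝ) :
    JetCoord N n r → ℝ :=
  L.foldr formalDeriv f

/-- The Lie-Euler operators on functions of order `≤ s`:
`𝓔^J_A (f) = ∑_{|K| ≤ s - |J|} (-1)^{|K|} (|J| + |K| choose |J|) d_K ∂^{JK}_A f`, for `|J| ≤ s`. -/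
noncomputable def lieEuler (s : ℕ) (A : Fin N) (J : Multiset (Fin n)) (f : JetCoord N n r → ℝ) :
    JetCoord N n r → ℝ := fun y ↦
  ∑ l ∈ Finset.range (s - Multiset.card J + 1), ∑ K : Fin l → Fin n,
    (-1) ^ l * ((Multiset.card J + l).choose (Multiset.card J) : ℝ) *
      iterFormalDeriv (List.ofFn K) (weightedPartial A (J + tupleIndex K) f) y

/-- The Helmholtz-Sonin expressions `𝓗^J_{AB} = ∂^J_B T_A - (-1)^{|J|} 𝓔^J_A (T_B)` of functions
`T_A` of order `≤ s`. -/
noncomputable def helmholtzExpr (s : ℕ) (T : Fin N → JetCoord N n r → ℝ) (J : Multiset (Fin n))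
    (A B : Fin N) : JetCoord N n r → ℝ := fun y ↦
  weightedPartial B J (T A) y - (-1) ^ Multiset.card J * lieEuler s A J (T B) y

/-- The coordinate expression of the projection `τ^{t,s}`. -/
def jetRestrict {s t : ℕ} (h : s ≤ t) (y : JetCoord N n t) : JetCoord N n s :=
  fun A J ↦ y A ⟨J.1, J.2.trans h⟩

end formal

section forms

variable (r N n : ℕ) (X : Type*) [TopologicalSpace X]
  [ChartedSpace (EuclideanSpace ℝ (Fin N)) X] [IsManifold (𝓡 N) ∞ X]

/-- The tangent space of `T^r_n X` at `p`. -/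
abbrev VelocityTangent {r N n : ℕ} {X : Type*} [TopologicalSpace X]
    [ChartedSpace (EuclideanSpace ℝ (Fin N)) X] [IsManifold (𝓡 N) ∞ X] (p : Velocity r N n X) :
    Type :=
  TangentSpace 𝓘(ℝ, JetCoord N n r) p

/-- (Not necessarily smooth) `1`-forms on `T^r_n X`. -/
abbrev OneForm : Type _ := ∀ p : Velocity r N n X, VelocityTangent p →L[ℝ] ℝ

/-- (Not necessarily smooth) `2`-forms on `T^r_n X`. -/
abbrev TwoForm : Type _ := ∀ p : Velocity r N n X, VelocityTangent p [⋀^Fin 2]→L[ℝ] ℝ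

variable {r N n X}

/-- The derivative at `y` of the inverse of the chart `ψ^r`; it maps the standard basis of the
coordinate space to the coordinate vectors `∂/∂x^A_J`. -/
noncomputable def Chart.frame (e : Chart N X) (y : JetCoord N n r) :
    JetCoord N n r →L[ℝ] VelocityTangent ((e.velocityChart r n).symm y) :=
  mfderiv 𝓘(ℝ, JetCoord N n r) 𝓘(ℝ, JetCoord N n r) (e.velocityChart r n).symm y

/-- The differential `dx^A_J` of the coordinate function `x^A_J` of the chart `ψ^r`. -/
noncomputable def Chart.dCoord (e : Chart N X) (A : Fin N) (J : Multiset (Fin n))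
    (p : Velocity r N n X) : VelocityTangent p →L[ℝ] ℝ :=
  mfderiv 𝓘(ℝ, JetCoord N n r) 𝓘(ℝ, ℝ)
    (fun v : Velocity r N n X ↦ jetEntry A J (e.velocityChart r n v)) p

/-- A `1`-form is smooth on the set `W` if its expressions in the associated charts are smooth. -/
def OneForm.SmoothOn (T : OneForm r N n X) (W : Set (Velocity r N n X)) : Prop :=
  ∀ e : Chart N X, ContDiffOn ℝ ∞
    (fun y : JetCoord N n r ↦ (T ((e.velocityChart r n).symm y)).comp (e.frame y))
    ((e.velocityChart r n).target ∩ (e.velocityChart r n).symm ⁻¹' W)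

/-- A `2`-form is smooth on the set `W` if its expressions in the associated charts are smooth. -/
def TwoForm.SmoothOn (H : TwoForm r N n X) (W : Set (Velocity r N n X)) : Prop :=
  ∀ e : Chart N X, ContDiffOn ℝ ∞
    (fun y : JetCoord N n r ↦
      (H ((e.velocityChart r n).symm y)).compContinuousLinearMap (e.frame y))
    ((e.velocityChart r n).target ∩ (e.velocityChart r n).symm ⁻¹' W)

/-- The component `T_A = T (∂/∂x^A)` of a `1`-form in the chart `ψ^r`, as a function of the
coordinates. -/
noncomputable def OneForm.component (T : OneForm r N n X) (e : Chart N X) (A : Fin N)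
    (y : JetCoord N n r) : ℝ :=
  T ((e.velocityChart r n).symm y) (e.frame y (Pi.single A (Pi.single ⟨0, Nat.zero_le r⟩ 1)))

/-- `T` is a differential equation on the open set `W ⊆ T^r_n X`: a smooth `1`-form that has the
expression `T = T_A dx^A` in every associated chart. -/
def OneForm.IsDifferentialEquationOn (T : OneForm r N n X) (W : Set (Velocity r N n X)) : Prop :=
  T.SmoothOn W ∧ ∀ e : Chart N X, ∀ p ∈ (e.velocityChart r n).source ∩ W,
    T p = ∑ A : Fin N, T.component e A (e.velocityChart r n p) • e.dCoord A 0 p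

/-- The wedge product of two covectors,
`(α ∧ β) (v₀, v₁) = α (v₀) β (v₁) - α (v₁) β (v₀)`; see `wedge_apply`. -/
noncomputable def wedge {M : Type*} [AddCommGroup M] [Module ℝ M] [TopologicalSpace M]
    (α β : M →L[ℝ] ℝ) : M [⋀^Fin 2]→L[ℝ] ℝ :=
  ((ContinuousMultilinearMap.mkPiAlgebra ℝ (Fin 2) ℝ).compContinuousLinearMap
    ![α, β]).alternatization

theorem wedge_apply {M : Type*} [AddCommGroup M] [Module ℝ M] [TopologicalSpace M]
    (α β : M →L[ℝ] ℝ) (v : Fin 2 → M) : wedge α β v = α (v 0) * β (v 1) - α (v 1) * β (v 0) := by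
  have hu : (Finset.univ : Finset (Equiv.Perm (Fin 2))) = {1, Equiv.swap 0 1} := by decide
  have hne : (1 : Equiv.Perm (Fin 2)) ≠ Equiv.swap 0 1 := by decide
  simp only [wedge, ContinuousMultilinearMap.alternatization_apply_apply, hu,
    Finset.sum_pair hne]
  simp [Fin.prod_univ_two]
  ring

/-- The local expression `∑_{|J| ≤ s} 𝓗^J_{AB} dx^B_J ∧ dx^A` on `T^t_n X` in the chart `ψ^t`
associated to the chart `ψ` of `X`, for a `1`-form `T` on `T^s_n X`, `s ≤ t`. -/
noncomputable def Chart.helmholtzForm {s t : ℕ} (e : Chart N X) (h : s ≤ t) (T : OneForm s N n X) :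
    TwoForm t N n X := fun p ↦
  ∑ k ∈ Finset.range (s + 1), ∑ j : Fin k → Fin n, ∑ A : Fin N, ∑ B : Fin N,
    helmholtzExpr s (fun C y ↦ T.component e C (jetRestrict h y)) (tupleIndex j) A B
        (e.velocityChart t n p) •
      wedge (e.dCoord B (tupleIndex j) p) (e.dCoord A 0 p)

end forms
end HelmholtzSonin

open HelmholtzSonin

/-! The local expression takes a pair of tangent vectors `(v, w)` to `B(v, w) - B(w, v)`, where
`B(a, b)` is the sum of `𝓗^J_{AB} a^B_J b^A` (`helmholtzBilin`, `Chart.helmholtzForm_apply`). It is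
therefore enough to show that `B` is unchanged when one chart is replaced by another; the forms of
the different charts then agree on overlaps, and their common value is smooth in every chart.

To understand `B`, write the point as the jet at `0` of a map `g` and the vectors as jets of `ξ` and
`η`; Taylor polynomials do this. Let `L` be the linearization at `g` of the differential operator `g
↦ T_A(j g)`. The terms `∂^J_B T_A ∂_J ξ^B` add up to `(L ξ)_A` by the chain rule. The terms
`(-1)^{|J|} 𝓔^J_A(T_B) ∂_J ξ^B` add up to `(L* ξ)_A`, with `L*` the formal adjoint: the Leibniz rule
for `(-1)^{|J|} ∂_J (c ξ)` produces exactly the binomial coefficients of the Lie-Euler operators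
(`sum_iterPartial_mul`, `sum_lieEuler_jetAt`). Since a formal derivative raises the order by one and
at most `s` of them act on functions of order `s`, truncated jets of order at least `2 s` suffice.
So `B` is the value at `0` of the sum of `η^A ((L - L*) ξ)_A` (`helmholtzBilin_jetAt`).

Now let `Φ` be a coordinate change on `X` and `M = DΦ` along `g`. Differentiating the transformation
law `T_A = T'_C ∂Φ^C/∂x^A` in the direction `ξ` gives `L = Mᵀ L' M + S` with the zeroth order
operator `S_{AB} = T'_C ∂²Φ^C/∂x^A ∂x^B` (`fderiv_change_frame`). As second derivatives commute, `S`
is symmetric, and passing to adjoints gives `L* = Mᵀ L'* M + S` (`adjOp_change_frame`). Hence `L -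
L* = Mᵀ (L' - L'*) M`: the Hessian term cancels. The jets of `M ξ` and `M η` are the images of the
jets of `ξ` and `η` under the derivative of the prolonged coordinate change (`fderiv_prolong`), so
this identity is the invariance of `B` (`helmholtzBilin_change_frame`).

The rule for adjoints is not computed from coefficients. It follows from integration by parts
against test functions and the fundamental lemma of the calculus of variations. -/

namespace HelmholtzSonin

/-! ### Sums over tuples versus sums over unordered multi-indices. -/

section tuples

theorem sum_tuple_succ {ι M : Type*} [Fintype ι] [AddCommMonoid M] (k : ℕ) (F : List ι → M) :
    ∑ j : Fin (k + 1) → ι, F (List.ofFn j) = ∑ i : ι, ∑ j : Fin k → ι, F (i :: List.ofFn j) := by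
  rw [← (Fin.consEquiv fun _ : Fin (k + 1) ↦ ι).sum_comp, Fintype.sum_prod_type]
  simp [Fin.consEquiv, List.ofFn_succ]

variable {n : ℕ}

theorem card_tupleIndex {k : ℕ} (j : Fin k → Fin n) : Multiset.card (tupleIndex j) = k := by
  simp [tupleIndex]

theorem sum_tupleIndex_succ {M : Type*} [AddCommMonoid M] (k : ℕ) (F : Multiset (Fin n) → M) :
    ∑ j : Fin (k + 1) → Fin n, F (tupleIndex j) =
      ∑ i, ∑ j : Fin k → Fin n, F (i ::ₘ tupleIndex j) :=
  sum_tuple_succ k fun L : List (Fin n) ↦ F (L : Multiset (Fin n))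

/-- The multinomial count of the orderings of `J`, without division. Induction on the first entry
`i` of the tuple: removing it leaves an ordering of `J` with one `i` less, and the multiplicities of
all `i` add up to `|J|`. -/
theorem card_tupleIndex_fiber (k : ℕ) (J : Multiset (Fin n)) (hJ : Multiset.card J = k) :
    (∑ j : Fin k → Fin n, if tupleIndex j = J then (1 : ℝ) else 0) * ∏ i, ((J.count i)! : ℝ) =
      k ! := by
  induction k generalizing J with
  | zero =>
    rw [Multiset.card_eq_zero] at hJ
    subst hJ
    simp [tupleIndex]
  | succ k ih =>
    have h2 (i : Fin n) : (∑ j : Fin k → Fin n,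
        if i ::ₘ tupleIndex j = J then (1 : ℝ) else 0) *
          ∏ l, ((J.count l)! : ℝ) = J.count i * k ! := by
      by_cases hi : i ∈ J
      · obtain ⟨J', rfl⟩ := Multiset.exists_cons_of_mem hi
        have hJ' : Multiset.card J' = k := by simpa using hJ
        rw [← ih J' hJ', Finset.prod_eq_mul_prod_sdiff_singleton_of_mem (Finset.mem_univ i),
          Finset.prod_eq_mul_prod_sdiff_singleton_of_mem (Finset.mem_univ i) (f := fun l ↦ ((J'.count l)! : ℝ))]
        have h3 : ∏ l ∈ Finset.univ \ {i}, (((i ::ₘ J').count l)! : ℝ) =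
            ∏ l ∈ Finset.univ \ {i}, ((J'.count l)! : ℝ) := by
          refine Finset.prod_congr rfl fun l hl ↦ ?_
          rw [Multiset.count_cons_of_ne (by simpa using hl)]
        simp only [h3, Multiset.count_cons_self, Nat.factorial_succ, Multiset.cons_inj_right]
        push_cast
        ring
      · rw [Multiset.count_eq_zero_of_notMem hi, Finset.sum_eq_zero]
        · simp
        · intro j _
          rw [if_neg]
          rintro rfl
          exact hi (by simp)
    rw [sum_tupleIndex_succ k fun K ↦ if K = J then (1 : ℝ) else 0, Finset.sum_mul, Finset.sum_congr rfl fun i _ ↦ h2 i, ← Finset.sum_mul,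
      Nat.factorial_succ, ← hJ]
    push_cast
    congr 1
    exact_mod_cast Multiset.sum_count_eq_card (s := Finset.univ) (m := J) (by simp)

/-- The weight of `weightedPartial` is the inverse of the number of orderings of `J`, so in a sum
over tuples each unordered multi-index is counted once. -/
theorem sum_multiIndex_eq (r : ℕ) (G : Multiset (Fin n) → ℝ) :
    ∑ J : MultiIndex n r, G J.1 = ∑ k ∈ Finset.range (r + 1), ∑ j : Fin k → Fin n,
      (∏ i, (((tupleIndex j).count i)! : ℝ)) / ((Multiset.card (tupleIndex j))! : ℝ) *
        G (tupleIndex j) := by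
  have h1 (k : ℕ) (hk : k ∈ Finset.range (r + 1)) (j : Fin k → Fin n) (x : ℝ) :
      x = ∑ J : MultiIndex n r, if tupleIndex j = J.1 then x else 0 := by
    have hk' := Finset.mem_range.1 hk
    rw [Finset.sum_eq_single (⟨tupleIndex j, by rw [card_tupleIndex]; omega⟩ : MultiIndex n r)]
    · simp
    · intro J _ hJ
      rw [if_neg fun h ↦ hJ (Subtype.ext h.symm)]
    · simp
  -- Sort the tuples by their multi-index: insert an indicator sum over `J`, exchange the sums, and
  -- count each fibre.
  rw [Finset.sum_congr rfl fun k hk ↦ Finset.sum_congr rfl fun j _ ↦ h1 k hk j _]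
  simp only [Finset.sum_comm (t := (Finset.univ : Finset (MultiIndex n r)))]
  refine Finset.sum_congr rfl fun J _ ↦ ?_
  rw [Finset.sum_eq_single (Multiset.card J.1)]
  · have h2 := card_tupleIndex_fiber _ J.1 rfl
    have h3 (j : Fin (Multiset.card J.1) → Fin n) : (if tupleIndex j = J.1 then
        (∏ i, (((tupleIndex j).count i)! : ℝ)) / ((Multiset.card (tupleIndex j))! : ℝ) *
        G (tupleIndex j) else 0) = (if tupleIndex j = J.1 then 1 else 0) *
        ((∏ i, ((J.1.count i)! : ℝ)) * (G J.1 / ((Multiset.card J.1)! : ℝ))) := by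
      split_ifs with h
      · rw [h]; ring
      · simp
    rw [Finset.sum_congr rfl fun j _ ↦ h3 j, ← Finset.sum_mul, ← mul_assoc, h2]
    field_simp
  · intro k _ hk
    refine Finset.sum_eq_zero fun j _ ↦ if_neg fun h ↦ hk ?_
    rw [← h, card_tupleIndex]
  · intro h
    exact absurd (Finset.mem_range.2 (Nat.lt_succ_of_le J.2)) h

end tuples

/-! ### Calculus of iterated partial derivatives: integration by parts, Leibniz rule, parameters. -/

section calculus

variable {n : ℕ} {U : Set (EuclideanSpace ℝ (Fin n))} {f g : EuclideanSpace ℝ (Fin n) → ℝ}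

theorem iterPartial_append (L L' : List (Fin n)) (f : EuclideanSpace ℝ (Fin n) → ℝ) :
    iterPartial (L ++ L') f = iterPartial L (iterPartial L' f) := by
  induction L with
  | nil => rfl
  | cons i L ih => simp only [List.cons_append, iterPartial, ih]

theorem iterPartial_add (hU : IsOpen U) (hf : ContDiffOn ℝ ∞ f U) (hg : ContDiffOn ℝ ∞ g U)
    (L : List (Fin n)) : Set.EqOn (iterPartial L fun t ↦ f t + g t)
      (fun t ↦ iterPartial L f t + iterPartial L g t) U := by
  induction L with
  | nil => intro t _; rfl
  | cons i L ih =>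
    intro t ht
    have h := (ih.eventuallyEq_of_mem (hU.mem_nhds ht)).fderiv_eq (𝕜 := ℝ)
    simp only [iterPartial, h]
    rw [fderiv_fun_add]
    · rfl
    · exact ((iterPartial_smooth hU hf L).contDiffAt (hU.mem_nhds ht)).differentiableAt (by simp)
    · exact ((iterPartial_smooth hU hg L).contDiffAt (hU.mem_nhds ht)).differentiableAt (by simp)

theorem iterPartial_const_mul (hU : IsOpen U) (hf : ContDiffOn ℝ ∞ f U) (c : ℝ)
    (L : List (Fin n)) : Set.EqOn (iterPartial L fun t ↦ c * f t)
      (fun t ↦ c * iterPartial L f t) U := by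
  induction L with
  | nil => intro t _; rfl
  | cons i L ih =>
    intro t ht
    have h := (ih.eventuallyEq_of_mem (hU.mem_nhds ht)).fderiv_eq (𝕜 := ℝ)
    simp only [iterPartial, h]
    rw [fderiv_const_mul]
    · rfl
    · exact ((iterPartial_smooth hU hf L).contDiffAt (hU.mem_nhds ht)).differentiableAt (by simp)

theorem iterPartial_zero (L : List (Fin n)) :
    iterPartial L (fun _ : EuclideanSpace ℝ (Fin n) ↦ (0 : ℝ)) = fun _ ↦ 0 := by
  induction L with
  | nil => rfl
  | cons i L ih => funext t; simp [iterPartial, ih]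

theorem iterPartial_sum {ι : Type*} (hU : IsOpen U) (s : Finset ι)
    {f : ι → EuclideanSpace ℝ (Fin n) → ℝ} (hf : ∀ i ∈ s, ContDiffOn ℝ ∞ (f i) U)
    (L : List (Fin n)) : Set.EqOn (iterPartial L fun t ↦ ∑ i ∈ s, f i t)
      (fun t ↦ ∑ i ∈ s, iterPartial L (f i) t) U := by
  classical
  induction s using Finset.induction_on with
  | empty => intro t _; simp [iterPartial_zero]
  | insert a s ha ih =>
    intro t ht
    simp only [Finset.sum_insert ha]
    rw [iterPartial_add hU (hf a (by simp)) (ContDiffOn.sum fun i hi ↦ hf i (by simp [hi])) L ht]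
    simp only
    rw [ih (fun i hi ↦ hf i (by simp [hi])) ht]

theorem iterPartial_translate (L : List (Fin n)) (f : EuclideanSpace ℝ (Fin n) → ℝ)
    (x t : EuclideanSpace ℝ (Fin n)) :
    iterPartial L (fun u ↦ f (u + x)) t = iterPartial L f (t + x) := by
  induction L generalizing t with
  | nil => rfl
  | cons i L ih =>
    have : iterPartial L (fun u ↦ f (u + x)) = fun u ↦ iterPartial L f (u + x) := funext ih
    simp only [iterPartial, this]
    rw [fderiv_comp_add_right]

theorem iterPartial_hasCompactSupport (hf : HasCompactSupport f) (L : List (Fin n)) :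
    HasCompactSupport (iterPartial L f) := by
  induction L with
  | nil => exact hf
  | cons i L ih => exact ih.fderiv_apply (𝕜 := ℝ) _

/-- Iterated integration by parts. -/
theorem integral_mul_iterPartial (hf : ContDiff ℝ ∞ f) (hf' : HasCompactSupport f)
    (hg : ContDiff ℝ ∞ g) (L : List (Fin n)) :
    ∫ t, f t * iterPartial L g t = (-1) ^ L.length * ∫ t, iterPartial L f t * g t := by
  have smooth {h : EuclideanSpace ℝ (Fin n) → ℝ} (hh : ContDiff ℝ ∞ h) (L : List (Fin n)) :
      ContDiff ℝ ∞ (iterPartial L h) :=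
    contDiffOn_univ.1 (iterPartial_smooth isOpen_univ hh.contDiffOn L)
  induction L generalizing f with
  | nil => simp [iterPartial]
  | cons i L ih =>
    have hL := smooth hg L
    have h1 : ∫ t, f t * iterPartial (i :: L) g t =
        - ∫ t, iterPartial [i] f t * iterPartial L g t := by
      refine integral_mul_fderiv_eq_neg_fderiv_mul_of_integrable ?_ ?_ ?_ ?_ ?_
      · exact ((smooth hf [i]).continuous.mul hL.continuous).integrable_of_hasCompactSupport
          (iterPartial_hasCompactSupport hf' [i]).mul_right
      · exact (hf.continuous.mul (smooth hg (i :: L)).continuous).integrable_of_hasCompactSupport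
          hf'.mul_right
      · exact (hf.continuous.mul hL.continuous).integrable_of_hasCompactSupport hf'.mul_right
      · exact fun x _ ↦ hf.differentiable (by simp) x
      · exact fun x _ ↦ hL.differentiable (by simp) x
    rw [h1, ih (smooth hf [i]) (iterPartial_hasCompactSupport hf' [i]), ← iterPartial_append]
    -- Integrating by parts from the outside inwards puts the derivatives on `f` in a different
    -- order; smoothness makes this harmless.
    have h2 : iterPartial (L ++ [i]) f = iterPartial (i :: L) f := by
      funext t
      exact iterPartial_perm isOpen_univ hf.contDiffOn List.perm_append_comm (Set.mem_univ t)
    rw [h2, List.length_cons, pow_succ]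
    ring

/-- The Leibniz rule, summed over all tuples of length `m`. -/
theorem sum_iterPartial_mul (hU : IsOpen U) (m : ℕ)
    (c : Multiset (Fin n) → EuclideanSpace ℝ (Fin n) → ℝ)
    (hc : ∀ J, ContDiffOn ℝ ∞ (c J) U) (hf : ContDiffOn ℝ ∞ f U) :
    Set.EqOn (fun t ↦ ∑ j : Fin m → Fin n,
        iterPartial (List.ofFn j) (fun t ↦ c (tupleIndex j) t * f t) t)
      (fun t ↦ ∑ q ∈ Finset.HasAntidiagonal.antidiagonal m, (m.choose q.1 : ℝ) *
        ∑ j : Fin q.1 → Fin n, ∑ k : Fin q.2 → Fin n,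
          iterPartial (List.ofFn k) (c (tupleIndex j + tupleIndex k)) t *
            iterPartial (List.ofFn j) f t) U := by
  induction m generalizing c with
  | zero => intro t _; simp [iterPartial, tupleIndex]
  | succ m ih =>
    intro t ht
    have hterm (i : Fin n) {p q : ℕ} (j : Fin p → Fin n) (k : Fin q → Fin n) :
        ContDiffOn ℝ ∞ (fun t ↦ iterPartial (List.ofFn k)
          (c (i ::ₘ (tupleIndex j + tupleIndex k))) t * iterPartial (List.ofFn j) f t) U :=
      (iterPartial_smooth hU (hc _) _).mul (iterPartial_smooth hU hf _)
    -- `G p q` collects the terms with `p` derivatives on `f` and `q` on the coefficient. As `c`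
    -- depends only on the unordered multi-index, all ways to choose which `p` derivatives hit `f`
    -- have the same sum, whence the binomial coefficient.
    let G : ℕ → ℕ → ℝ := fun p q ↦ ∑ j : Fin p → Fin n, ∑ k : Fin q → Fin n,
          iterPartial (List.ofFn k) (c (tupleIndex j + tupleIndex k)) t *
            iterPartial (List.ofFn j) f t
    have h1 (i : Fin n) : ∑ j : Fin m → Fin n, iterPartial (i :: List.ofFn j)
          (fun t ↦ c (i ::ₘ tupleIndex j) t * f t) t =
        ∑ q ∈ Finset.HasAntidiagonal.antidiagonal m, (m.choose q.1 : ℝ) *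
          ∑ j : Fin q.1 → Fin n, ∑ k : Fin q.2 → Fin n,
            (iterPartial (i :: List.ofFn k) (c (i ::ₘ (tupleIndex j + tupleIndex k))) t *
              iterPartial (List.ofFn j) f t +
            iterPartial (List.ofFn k) (c (i ::ₘ (tupleIndex j + tupleIndex k))) t *
              iterPartial (i :: List.ofFn j) f t) := by
      have h2 := iterPartial_congr hU (ih (fun J ↦ c (i ::ₘ J)) (fun J ↦ hc _)) [i] ht
      rw [iterPartial_sum hU _ (fun j _ ↦ iterPartial_smooth hU ((hc _).mul hf) _) [i] ht,
        iterPartial_sum hU _ (fun q _ ↦ contDiffOn_const.mul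
          (ContDiffOn.sum fun j _ ↦ ContDiffOn.sum fun k _ ↦ hterm i j k)) [i] ht] at h2
      simp only at h2
      refine h2.trans (Finset.sum_congr rfl fun q _ ↦ ?_)
      rw [iterPartial_const_mul hU
        (ContDiffOn.sum fun j _ ↦ ContDiffOn.sum fun k _ ↦ hterm i j k) _ [i] ht]
      simp only
      congr 1
      rw [iterPartial_sum hU _ (fun j _ ↦ ContDiffOn.sum fun k _ ↦ hterm i j k) [i] ht]
      refine Finset.sum_congr rfl fun j _ ↦ ?_
      rw [iterPartial_sum hU _ (fun k _ ↦ hterm i j k) [i] ht]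
      refine Finset.sum_congr rfl fun k _ ↦ ?_
      have hd {h : EuclideanSpace ℝ (Fin n) → ℝ} (hh : ContDiffOn ℝ ∞ h U) (L : List (Fin n)) :
          DifferentiableAt ℝ (iterPartial L h) t :=
        ((iterPartial_smooth hU hh L).contDiffAt (hU.mem_nhds ht)).differentiableAt (by simp)
      simp only [iterPartial]
      rw [fderiv_fun_mul (hd (hc _) _) (hd hf _)]
      simp only [add_apply, smul_apply, smul_eq_mul]
      ring
    have hL : ∑ j : Fin (m + 1) → Fin n,
        iterPartial (List.ofFn j) (fun t ↦ c (tupleIndex j) t * f t) t =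
        ∑ q ∈ Finset.HasAntidiagonal.antidiagonal m, ((m.choose q.1 : ℝ) * G q.1 (q.2 + 1) +
          (m.choose q.2 : ℝ) * G (q.1 + 1) q.2) := by
      have := sum_tuple_succ m
        (fun L : List (Fin n) ↦ iterPartial L (fun t ↦ c (L : Multiset (Fin n)) t * f t) t)
      simp only [tupleIndex] at this h1 ⊢
      rw [this]
      simp only [← Multiset.cons_coe]
      rw [Finset.sum_congr rfl fun i _ ↦ h1 i, Finset.sum_comm]
      refine Finset.sum_congr rfl fun q hq ↦ ?_
      -- The new derivative `∂_i` falls on the coefficient or on `f`, so `G p q` yields `G p (q +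
      -- 1)` and `G (p + 1) q`. The symmetry of binomials gives the two sums the shape in which
      -- Pascal's rule combines them.
      have hch : m.choose q.2 = m.choose q.1 := by
        rw [← Finset.HasAntidiagonal.mem_antidiagonal.1 hq, Nat.choose_symm_add]
      rw [hch, ← Finset.mul_sum, ← mul_add]
      congr 1
      simp only [Finset.sum_add_distrib]
      congr 1
      · simp only [G, tupleIndex]
        rw [Finset.sum_comm]
        refine Finset.sum_congr rfl fun j _ ↦ ?_
        have := sum_tuple_succ q.2 (fun L : List (Fin n) ↦
          iterPartial L (c ((List.ofFn j : Multiset (Fin n)) + (L : Multiset (Fin n)))) t *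
            iterPartial (List.ofFn j) f t)
        rw [this]
        simp only [← Multiset.cons_coe, Multiset.add_cons]
      · simp only [G, tupleIndex]
        have := sum_tuple_succ q.1 (fun L : List (Fin n) ↦ ∑ k : Fin q.2 → Fin n,
          iterPartial (List.ofFn k) (c ((L : Multiset (Fin n)) + (List.ofFn k : Multiset (Fin n)))) t *
            iterPartial L f t)
        rw [this]
        simp only [← Multiset.cons_coe, Multiset.cons_add]
    simp only
    rw [hL, Finset.sum_add_distrib]
    exact (Finset.sum_antidiagonal_choose_succ_mul G m).symm

/-- Differentiation with respect to a parameter commutes with partial derivatives. -/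
theorem hasDerivAt_iterPartial {P : Set (ℝ × EuclideanSpace ℝ (Fin n))} (hP : IsOpen P)
    {F : ℝ × EuclideanSpace ℝ (Fin n) → ℝ} (hF : ContDiffOn ℝ ∞ F P) (L : List (Fin n))
    {q : ℝ × EuclideanSpace ℝ (Fin n)} (hq : q ∈ P) :
    HasDerivAt (fun ε ↦ iterPartial L (fun t ↦ F (ε, t)) q.2)
      (iterPartial L (fun t ↦ deriv (fun ε ↦ F (ε, t)) q.1) q.2) q.1 := by
  induction L generalizing q with
  | nil =>
    have h1 : DifferentiableAt ℝ F q :=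
      (hF.contDiffAt (hP.mem_nhds hq)).differentiableAt (by simp)
    have h2 : DifferentiableAt ℝ (fun ε : ℝ ↦ (ε, q.2)) q.1 := by fun_prop
    exact (DifferentiableAt.comp q.1 (f := fun ε : ℝ ↦ (ε, q.2)) h1 h2).hasDerivAt
  | cons i L ih =>
    have hG := iterPartial_contDiffOn hP hF L
    set G : ℝ × EuclideanSpace ℝ (Fin n) → ℝ := fun q ↦ iterPartial L (fun t ↦ F (q.1, t)) q.2
    have hGd {p} (hp : p ∈ P) : DifferentiableAt ℝ G p :=
      (hG.contDiffAt (hP.mem_nhds hp)).differentiableAt (by simp)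
    have hpart {p} (hp : p ∈ P) : iterPartial (i :: L) (fun t ↦ F (p.1, t)) p.2 =
        fderiv ℝ G p (0, EuclideanSpace.single i 1) := by
      have := (HasFDerivAt.comp p.2 (f := fun t : EuclideanSpace ℝ (Fin n) ↦ (p.1, t))
        (hGd hp).hasFDerivAt (hasFDerivAt_prodMk_right p.1 p.2)).fderiv
      have h2 : G ∘ (fun t ↦ (p.1, t)) = iterPartial L (fun t ↦ F (p.1, t)) := rfl
      rw [h2] at this
      simp only [iterPartial, this]
      simp
    -- By uniqueness of derivatives, the induction hypothesis identifies the parameter derivative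
    -- with a directional derivative of `G`; the claim becomes the symmetry of the second derivative
    -- of `G`.
    have htime {p} (hp : p ∈ P) : iterPartial L (fun t ↦ deriv (fun ε ↦ F (ε, t)) p.1) p.2 =
        fderiv ℝ G p (1, 0) := by
      have h1 : HasDerivAt (fun ε ↦ G (ε, p.2)) (fderiv ℝ G p (1, 0)) p.1 := by
        have := HasFDerivAt.comp_hasDerivAt p.1 (f := fun ε : ℝ ↦ (ε, p.2)) (hGd hp).hasFDerivAt
          ((hasDerivAt_id p.1).prodMk (hasDerivAt_const p.1 p.2))
        exact this
      exact (ih hp).unique h1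
    have hat : ContDiffAt ℝ ∞ G q := hG.contDiffAt (hP.mem_nhds hq)
    have hsym : IsSymmSndFDerivAt ℝ G q := hat.isSymmSndFDerivAt (by
      rw [minSmoothness_of_isRCLikeNormedField]
      exact WithTop.coe_le_coe.2 (le_top : (2 : ℕ∞) ≤ ⊤))
    have hd : DifferentiableAt ℝ (fderiv ℝ G) q :=
      (hat.fderiv_right (m := ∞) (by simp)).differentiableAt (by simp)
    have key (v : ℝ × EuclideanSpace ℝ (Fin n)) :
        HasFDerivAt (fun p ↦ fderiv ℝ G p v) ((fderiv ℝ (fderiv ℝ G) q).flip v) q := by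
      have := hd.hasFDerivAt.clm_apply (hasFDerivAt_const v q)
      simpa using this
    have h1 : iterPartial (i :: L) (fun t ↦ deriv (fun ε ↦ F (ε, t)) q.1) q.2 =
        fderiv ℝ (fderiv ℝ G) q (0, EuclideanSpace.single i 1) (1, 0) := by
      have h2 : iterPartial L (fun t ↦ deriv (fun ε ↦ F (ε, t)) q.1) =ᶠ[𝓝 q.2]
          fun t ↦ fderiv ℝ G (q.1, t) (1, 0) := by
        have : ∀ᶠ t in 𝓝 q.2, (q.1, t) ∈ P :=
          (Continuous.prodMk_right q.1).continuousAt.eventually (hP.mem_nhds hq)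
        filter_upwards [this] with t ht
        exact htime ht
      simp only [iterPartial, h2.fderiv_eq]
      have := (HasFDerivAt.comp q.2 (f := fun t : EuclideanSpace ℝ (Fin n) ↦ (q.1, t))
        (key (1, 0)) (hasFDerivAt_prodMk_right q.1 q.2)).fderiv
      have h3 : (fun p ↦ fderiv ℝ G p (1, 0)) ∘ (fun t ↦ (q.1, t)) =
        fun t ↦ fderiv ℝ G (q.1, t) (1, 0) := rfl
      rw [h3] at this
      rw [this]
      simp
    rw [h1, hsym]
    have h4 : HasDerivAt (fun ε ↦ fderiv ℝ G (ε, q.2) (0, EuclideanSpace.single i 1))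
        (fderiv ℝ (fderiv ℝ G) q (1, 0) (0, EuclideanSpace.single i 1)) q.1 := by
      have := HasFDerivAt.comp_hasDerivAt q.1 (f := fun ε : ℝ ↦ (ε, q.2))
          (key (0, EuclideanSpace.single i 1))
          ((hasDerivAt_id q.1).prodMk (hasDerivAt_const q.1 q.2))
      exact this
    refine h4.congr_of_eventuallyEq ?_
    have : ∀ᶠ ε in 𝓝 q.1, (ε, q.2) ∈ P :=
      (Continuous.prodMk_left q.2).continuousAt.eventually (hP.mem_nhds hq)
    filter_upwards [this] with ε hε
    exact hpart hε

end calculus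

/-! ### The order of a function on jet space, and how the operators change it. -/

section order

variable {N n r q : ℕ} {f : JetCoord N n r → ℝ}

/-- The function `f` depends only on the coordinates of order at most `q`. -/
def HasOrder (q : ℕ) (f : JetCoord N n r → ℝ) : Prop :=
  ∀ y y' : JetCoord N n r, (∀ A (J : MultiIndex n r), Multiset.card J.1 ≤ q → y A J = y' A J) →
    f y = f y'

/-- No differentiability is needed: if `y` and `y'` agree up to order `q`, the translates of `f` by
them are the same function, so the two derivatives agree, default values included. -/
theorem HasOrder.fderiv_apply (hf : HasOrder q f) (v : JetCoord N n r) :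
    HasOrder q fun y ↦ fderiv ℝ f y v := by
  intro y y' h
  have h1 : (fun z ↦ f (z + y)) = fun z ↦ f (z + y') :=
    funext fun z ↦ hf _ _ fun A J hJ ↦ by simp [h A J hJ]
  have h2 (x : JetCoord N n r) : fderiv ℝ f x = fderiv ℝ (fun z ↦ f (z + x)) 0 := by
    rw [fderiv_comp_add_right, zero_add]
  simp only
  rw [h2 y, h2 y', h1]

theorem HasOrder.weightedPartial (hf : HasOrder q f) (A : Fin N) (J : Multiset (Fin n)) :
    HasOrder q (weightedPartial A J f) := by
  intro y y' h
  simp only [HelmholtzSonin.weightedPartial]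
  split_ifs
  · exact congrArg _ (hf.fderiv_apply _ y y' h)
  · rfl

/-- Along a coordinate of order greater than `q` the function is constant. Where `f` is not
differentiable, `fderiv` has the default value zero. -/
theorem HasOrder.weightedPartial_eq_zero (hf : HasOrder q f) (A : Fin N) {J : Multiset (Fin n)}
    (hJ : q < Multiset.card J) (y : JetCoord N n r) :
    HelmholtzSonin.weightedPartial A J f y = 0 := by
  simp only [HelmholtzSonin.weightedPartial]
  split_ifs with h
  · refine mul_eq_zero_of_right _ ?_
    by_cases hd : DifferentiableAt ℝ f y
    · have h1 := hd.hasFDerivAt.hasLineDerivAt (Pi.single A (Pi.single ⟨J, h⟩ 1))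
      have h2 : HasLineDerivAt ℝ f 0 y (Pi.single A (Pi.single ⟨J, h⟩ 1)) := by
        have h3 : (fun τ : ℝ ↦ f (y + τ • (Pi.single A (Pi.single ⟨J, h⟩ 1) : JetCoord N n r))) = fun _ ↦ f y := by
          refine funext fun τ ↦ hf _ _ fun B K hK ↦ ?_
          have hne : K ≠ ⟨J, h⟩ := by rintro rfl; simp at hK; omega
          by_cases hB : B = A
          · subst hB; simp [hne]
          · simp [hB]
        simp only [HasLineDerivAt, h3]
        exact hasDerivAt_const _ _
      exact h1.lineDeriv.symm.trans h2.lineDeriv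
    · simp [fderiv_zero_of_not_differentiableAt hd]
  · rfl

/-- The coefficient `x^A_{iJ}` has order `|J| + 1`, and it only survives for `|J| ≤ q`, where `∂^J_A
f` need not vanish. -/
theorem HasOrder.formalDeriv (hf : HasOrder q f) (i : Fin n) :
    HasOrder (q + 1) (formalDeriv i f) := by
  intro y y' h
  simp only [HelmholtzSonin.formalDeriv]
  refine Finset.sum_congr rfl fun k _ ↦ Finset.sum_congr rfl fun j _ ↦
    Finset.sum_congr rfl fun A _ ↦ ?_
  by_cases hk : k ≤ q
  · rw [hf.weightedPartial A _ y y' fun B J hJ ↦ h B J (by omega)]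
    simp only [jetEntry]
    split_ifs
    · rw [h]
      simpa [card_tupleIndex] using hk
    · rfl
  · rw [hf.weightedPartial_eq_zero A (by rw [card_tupleIndex]; omega),
      hf.weightedPartial_eq_zero A (by rw [card_tupleIndex]; omega), mul_zero, mul_zero]

theorem HasOrder.iterFormalDeriv (hf : HasOrder q f) (L : List (Fin n)) :
    HasOrder (q + L.length) (iterFormalDeriv L f) := by
  induction L with
  | nil => exact hf
  | cons i L ih => exact ih.formalDeriv i

theorem hasOrder_comp_jetRestrict {s t : ℕ} (h : s ≤ t) (g : JetCoord N n s → ℝ) :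
    HasOrder s fun y : JetCoord N n t ↦ g (jetRestrict h y) :=
  fun _ _ hy ↦ congrArg g (funext fun A ↦ funext fun J ↦ hy A _ J.2)

end order

/-! ### Smoothness of the operators, and the differential in terms of weighted partials. -/

section smooth

variable {N n r : ℕ} {f : JetCoord N n r → ℝ} {Ω : Set (JetCoord N n r)}

theorem contDiff_jetEntry (A : Fin N) (J : Multiset (Fin n)) :
    ContDiff ℝ ∞ (jetEntry A J : JetCoord N n r → ℝ) := by
  unfold jetEntry
  split_ifs
  · fun_prop
  · exact contDiff_const

theorem contDiffOn_weightedPartial (hΩ : IsOpen Ω) (hf : ContDiffOn ℝ ∞ f Ω) (A : Fin N)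
    (J : Multiset (Fin n)) : ContDiffOn ℝ ∞ (weightedPartial A J f) Ω := by
  unfold weightedPartial
  split_ifs
  · exact contDiffOn_const.mul ((hf.fderiv_of_isOpen hΩ (by simp)).clm_apply contDiffOn_const)
  · exact contDiffOn_const

theorem contDiffOn_formalDeriv (hΩ : IsOpen Ω) (hf : ContDiffOn ℝ ∞ f Ω) (i : Fin n) :
    ContDiffOn ℝ ∞ (formalDeriv i f) Ω :=
  ContDiffOn.sum fun _ _ ↦ ContDiffOn.sum fun _ _ ↦ ContDiffOn.sum fun _ _ ↦
    (contDiff_jetEntry _ _).contDiffOn.mul (contDiffOn_weightedPartial hΩ hf _ _)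

theorem contDiffOn_iterFormalDeriv (hΩ : IsOpen Ω) (hf : ContDiffOn ℝ ∞ f Ω) (L : List (Fin n)) :
    ContDiffOn ℝ ∞ (iterFormalDeriv L f) Ω := by
  induction L with
  | nil => exact hf
  | cons i L ih => exact contDiffOn_formalDeriv hΩ ih i

theorem contDiffOn_helmholtzExpr (hΩ : IsOpen Ω) (s : ℕ) {T : Fin N → JetCoord N n r → ℝ}
    (hT : ∀ A, ContDiffOn ℝ ∞ (T A) Ω) (J : Multiset (Fin n)) (A B : Fin N) :
    ContDiffOn ℝ ∞ (helmholtzExpr s T J A B) Ω :=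
  (contDiffOn_weightedPartial hΩ (hT A) B J).sub <| contDiffOn_const.mul <|
    ContDiffOn.sum fun _ _ ↦ ContDiffOn.sum fun _ _ ↦ contDiffOn_const.mul <|
      contDiffOn_iterFormalDeriv hΩ (contDiffOn_weightedPartial hΩ (hT B) _ _) _

/-- Expand `a` in the standard basis, which is labelled by unordered multi-indices;
`sum_multiIndex_eq` turns this into a sum over tuples, whose weights are those of `weightedPartial`.
-/
theorem fderiv_eq_sum_weightedPartial (f : JetCoord N n r → ℝ) (y a : JetCoord N n r) :
    fderiv ℝ f y a = ∑ k ∈ Finset.range (r + 1), ∑ j : Fin k → Fin n, ∑ A : Fin N,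
      weightedPartial A (tupleIndex j) f y * jetEntry A (tupleIndex j) a := by
  have ha : a = ∑ A : Fin N, ∑ J : MultiIndex n r, a A J • Pi.single A (Pi.single J 1) := by
    funext B K
    simp only [Finset.sum_apply, Pi.smul_apply]
    rw [Finset.sum_eq_single B, Finset.sum_eq_single K]
    · simp
    · intro J _ hJ; simp [hJ.symm]
    · simp
    · intro A _ hA; simp [hA.symm]
    · simp
  have h1 := sum_multiIndex_eq r fun J : Multiset (Fin n) ↦ ∑ A : Fin N,
    if h : Multiset.card J ≤ r then
      a A ⟨J, h⟩ * fderiv ℝ f y (Pi.single A (Pi.single ⟨J, h⟩ 1)) else 0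
  conv_lhs => rw [ha]
  simp only [map_sum, map_smul, smul_eq_mul]
  rw [Finset.sum_comm]
  refine (Finset.sum_congr rfl fun J _ ↦ Finset.sum_congr rfl fun A _ ↦ ?_).trans (h1.trans ?_)
  · rw [dif_pos J.2]
  · refine Finset.sum_congr rfl fun k _ ↦ Finset.sum_congr rfl fun j _ ↦ ?_
    rw [Finset.mul_sum]
    refine Finset.sum_congr rfl fun A _ ↦ ?_
    simp only [weightedPartial, jetEntry]
    split_ifs
    · ring
    · ring

theorem HasOrder.fderiv_eq_sum {q : ℕ} (hf : HasOrder q f) (hq : q ≤ r) (y a : JetCoord N n r) :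
    fderiv ℝ f y a = ∑ k ∈ Finset.range (q + 1), ∑ j : Fin k → Fin n, ∑ A : Fin N,
      HelmholtzSonin.weightedPartial A (tupleIndex j) f y * jetEntry A (tupleIndex j) a := by
  rw [fderiv_eq_sum_weightedPartial]
  refine (Finset.sum_subset (Finset.range_mono (by omega)) fun k _ hk ↦ ?_).symm
  refine Finset.sum_eq_zero fun j _ ↦ Finset.sum_eq_zero fun A _ ↦ ?_
  rw [hf.weightedPartial_eq_zero A, zero_mul]
  rw [card_tupleIndex]
  simpa using hk

end smooth

/-! ### Formal derivatives and Lie-Euler operators along the jet of a map. -/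

section along

variable {N n r : ℕ} {U : Set (EuclideanSpace ℝ (Fin n))}
  {g : EuclideanSpace ℝ (Fin n) → EuclideanSpace ℝ (Fin N)}

/-- The `r`-jet of `g` at the point `t`, in coordinates. -/
noncomputable def jetAt (r : ℕ) (g : EuclideanSpace ℝ (Fin n) → EuclideanSpace ℝ (Fin N))
    (t : EuclideanSpace ℝ (Fin n)) : JetCoord N n r :=
  fun A J ↦ iterPartial J.1.toList (fun u ↦ g u A) t

theorem jetAt_zero (r : ℕ) (g : EuclideanSpace ℝ (Fin n) → EuclideanSpace ℝ (Fin N)) :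
    jetAt r g 0 = jet r g := rfl

theorem jetAt_eq_jet (r : ℕ) (g : EuclideanSpace ℝ (Fin n) → EuclideanSpace ℝ (Fin N))
    (t : EuclideanSpace ℝ (Fin n)) : jetAt r g t = jet r fun u ↦ g (u + t) := by
  funext A J
  simp only [jet, jetAt]
  rw [iterPartial_translate _ (fun u ↦ g u A), zero_add]

theorem jetBase_jetAt (t : EuclideanSpace ℝ (Fin n)) : jetBase (jetAt r g t) = g t := by
  rw [jetAt_eq_jet, jetBase_jet, zero_add]

theorem contDiffOn_coord (hg : ContDiffOn ℝ ∞ g U) (A : Fin N) :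
    ContDiffOn ℝ ∞ (fun t ↦ g t A) U :=
  (coordProj N A).contDiff.comp_contDiffOn hg

theorem contDiffOn_jetAt (hU : IsOpen U) (hg : ContDiffOn ℝ ∞ g U) (r : ℕ) :
    ContDiffOn ℝ ∞ (jetAt r g) U := by
  rw [contDiffOn_pi]
  intro A
  rw [contDiffOn_pi]
  intro J
  exact iterPartial_smooth hU (contDiffOn_coord hg A) _

theorem jetEntry_jetAt (hU : IsOpen U) (hg : ContDiffOn ℝ ∞ g U) {t : EuclideanSpace ℝ (Fin n)}
    (ht : t ∈ U) (A : Fin N) (L : List (Fin n)) (hL : L.length ≤ r) :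
    jetEntry A L (jetAt r g t) = iterPartial L (fun u ↦ g u A) t := by
  rw [jetEntry, dif_pos (by simpa using hL)]
  refine iterPartial_perm hU (contDiffOn_coord hg A) ?_ ht
  rw [← Multiset.coe_eq_coe, Multiset.coe_toList]

/-- By the chain rule the formal derivative is the actual derivative of `f` along the jet. The bound
`q < r` is essential: the chain rule also has a term with the derivatives of `g` of order `r + 1`,
which the truncated formal derivative omits. -/
theorem formalDeriv_jetAt (hU : IsOpen U) (hg : ContDiffOn ℝ ∞ g U) {Ω : Set (JetCoord N n r)}
    (hΩ : IsOpen Ω) (hgΩ : Set.MapsTo (jetAt r g) U Ω) {f : JetCoord N n r → ℝ}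
    (hf : ContDiffOn ℝ ∞ f Ω) {q : ℕ} (hfq : HasOrder q f) (hq : q < r) (i : Fin n)
    {t : EuclideanSpace ℝ (Fin n)} (ht : t ∈ U) :
    formalDeriv i f (jetAt r g t) = iterPartial [i] (f ∘ jetAt r g) t := by
  have hj : DifferentiableAt ℝ (jetAt r g) t :=
    ((contDiffOn_jetAt hU hg r).contDiffAt (hU.mem_nhds ht)).differentiableAt (by simp)
  have hd : DifferentiableAt ℝ f (jetAt r g t) :=
    (hf.contDiffAt (hΩ.mem_nhds (hgΩ ht))).differentiableAt (by simp)
  simp only [iterPartial]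
  rw [fderiv_comp _ hd hj, ContinuousLinearMap.comp_apply, fderiv_eq_sum_weightedPartial,
    Finset.sum_range_succ, formalDeriv]
  -- The omitted top term `|J| = r` is zero because `f` has order less than `r`.
  refine (add_zero _).symm.trans (congrArg₂ (· + ·) ?_ (Eq.symm ?_))
  · refine Finset.sum_congr rfl fun k hk ↦ Finset.sum_congr rfl fun j _ ↦
      Finset.sum_congr rfl fun A _ ↦ ?_
    have hk := Finset.mem_range.1 hk
    rw [mul_comm]
    congr 1
    have h1 : jetEntry A (i ::ₘ tupleIndex j) (jetAt r g t) = _ :=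
      jetEntry_jetAt hU hg ht A (i :: List.ofFn j) (by simpa using hk)
    have h2 : fderiv ℝ (fun u ↦ jetEntry A (tupleIndex j) (jetAt r g u)) t
        (EuclideanSpace.single i 1) = jetEntry A (tupleIndex j)
          (fderiv ℝ (jetAt r g) t (EuclideanSpace.single i 1)) := by
      have hle : Multiset.card (tupleIndex j) ≤ r := by rw [card_tupleIndex]; omega
      simp only [jetEntry, dif_pos hle]
      have h3 := hasFDerivAt_pi'.1 (hasFDerivAt_pi'.1 hj.hasFDerivAt A) ⟨tupleIndex j, hle⟩
      exact congrArg (fun l ↦ l (EuclideanSpace.single i 1)) h3.fderiv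
    rw [h1, ← h2]
    have h4 : (fun u ↦ jetEntry A (tupleIndex j) (jetAt r g u)) =ᶠ[𝓝 t]
        iterPartial (List.ofFn j) (fun u ↦ g u A) := by
      filter_upwards [hU.mem_nhds ht] with u hu
      exact jetEntry_jetAt hU hg hu A (List.ofFn j) (by simpa using hk.le)
    simp only [iterPartial]
    rw [h4.fderiv_eq]
  · refine Finset.sum_eq_zero fun j _ ↦ Finset.sum_eq_zero fun A _ ↦ ?_
    rw [hfq.weightedPartial_eq_zero A (by rw [card_tupleIndex]; exact hq), zero_mul]

theorem iterFormalDeriv_jetAt (hU : IsOpen U) (hg : ContDiffOn ℝ ∞ g U)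
    {Ω : Set (JetCoord N n r)} (hΩ : IsOpen Ω) (hgΩ : Set.MapsTo (jetAt r g) U Ω)
    {f : JetCoord N n r → ℝ} (hf : ContDiffOn ℝ ∞ f Ω) {q : ℕ} (hfq : HasOrder q f)
    (L : List (Fin n)) (hq : q + L.length ≤ r) :
    Set.EqOn (iterFormalDeriv L f ∘ jetAt r g) (iterPartial L (f ∘ jetAt r g)) U := by
  induction L with
  | nil => intro t _; rfl
  | cons i L ih =>
    intro t ht
    simp only [List.length_cons] at hq
    have h1 := formalDeriv_jetAt hU hg hΩ hgΩ (contDiffOn_iterFormalDeriv hΩ hf L)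
      (hfq.iterFormalDeriv L) (by omega) i ht
    exact h1.trans (iterPartial_congr hU (ih (by omega)) [i] ht)

/-- Along a jet, the Lie-Euler operators are the coefficients of the formal adjoint of the
linearization. -/
theorem sum_lieEuler_jetAt (hU : IsOpen U) (hg : ContDiffOn ℝ ∞ g U)
    {Ω : Set (JetCoord N n r)} (hΩ : IsOpen Ω) (hgΩ : Set.MapsTo (jetAt r g) U Ω)
    {f : JetCoord N n r → ℝ} (hf : ContDiffOn ℝ ∞ f Ω) {s : ℕ} (hfs : HasOrder s f)
    (hs : 2 * s ≤ r) (A : Fin N) {u : EuclideanSpace ℝ (Fin n) → ℝ} (hu : ContDiffOn ℝ ∞ u U)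
    {t : EuclideanSpace ℝ (Fin n)} (ht : t ∈ U) :
    ∑ k ∈ Finset.range (s + 1), ∑ j : Fin k → Fin n,
        (-1) ^ k * lieEuler s A (tupleIndex j) f (jetAt r g t) * iterPartial (List.ofFn j) u t =
      ∑ k ∈ Finset.range (s + 1), ∑ j : Fin k → Fin n, (-1) ^ k * iterPartial (List.ofFn j)
        (fun t ↦ weightedPartial A (tupleIndex j) f (jetAt r g t) * u t) t := by
  have hc (J : Multiset (Fin n)) :
      ContDiffOn ℝ ∞ (fun t ↦ weightedPartial A J f (jetAt r g t)) U :=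
    (contDiffOn_weightedPartial hΩ hf A J).comp (contDiffOn_jetAt hU hg r) hgΩ
  -- Here `p` is the number of derivatives on `u` and `q` the number on the coefficient. The
  -- Lie-Euler side sums `G` by rows, the Leibniz side by diagonals `p + q = m`, over the same
  -- triangle `p + q ≤ s`.
  let G : ℕ → ℕ → ℝ := fun p q ↦ (-1) ^ (p + q) * ((p + q).choose p : ℝ) *
    ∑ j : Fin p → Fin n, ∑ k : Fin q → Fin n, iterPartial (List.ofFn k)
      (fun t ↦ weightedPartial A (tupleIndex j + tupleIndex k) f (jetAt r g t)) t *
        iterPartial (List.ofFn j) u t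
  have hR (m : ℕ) : ∑ j : Fin m → Fin n, (-1) ^ m * iterPartial (List.ofFn j)
        (fun t ↦ weightedPartial A (tupleIndex j) f (jetAt r g t) * u t) t =
      ∑ q ∈ Finset.HasAntidiagonal.antidiagonal m, G q.1 q.2 := by
    rw [← Finset.mul_sum]
    have := sum_iterPartial_mul hU m (fun J t ↦ weightedPartial A J f (jetAt r g t)) hc hu ht
    simp only at this
    rw [this, Finset.mul_sum]
    refine Finset.sum_congr rfl fun q hq ↦ ?_
    simp only [G, Finset.HasAntidiagonal.mem_antidiagonal.1 hq, mul_assoc]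
  have hL (p : ℕ) (hp : p ∈ Finset.range (s + 1)) : ∑ j : Fin p → Fin n,
      (-1) ^ p * lieEuler s A (tupleIndex j) f (jetAt r g t) * iterPartial (List.ofFn j) u t =
        ∑ q ∈ Finset.range (s + 1 - p), G p q := by
    have hp := Finset.mem_range.1 hp
    have hsp : s - p + 1 = s + 1 - p := by omega
    simp only [lieEuler, card_tupleIndex, hsp, G, Finset.mul_sum, Finset.sum_mul]
    rw [Finset.sum_comm]
    refine Finset.sum_congr rfl fun q hq ↦ Finset.sum_congr rfl fun j _ ↦
      Finset.sum_congr rfl fun k _ ↦ ?_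
    have hq := Finset.mem_range.1 hq
    -- The assumption `2 * s ≤ r` enters here: at most `s` formal derivatives act on a function of
    -- order `s`.
    have h1 : iterFormalDeriv (List.ofFn k) (weightedPartial A (tupleIndex j + tupleIndex k) f)
        (jetAt r g t) = _ := iterFormalDeriv_jetAt hU hg hΩ hgΩ
      (contDiffOn_weightedPartial hΩ hf A (tupleIndex j + tupleIndex k))
      (hfs.weightedPartial A _) (List.ofFn k) (by rw [List.length_ofFn]; omega) ht
    rw [h1, pow_add]
    simp only [Function.comp_def]
    ring
  rw [Finset.sum_congr rfl hL, Finset.sum_congr rfl fun m _ ↦ hR m]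
  have h2 (m : ℕ) : ∑ q ∈ Finset.HasAntidiagonal.antidiagonal m, G q.1 q.2 =
      ∑ p ∈ Finset.range (m + 1), G p (m - p) :=
    Finset.Nat.sum_antidiagonal_eq_sum_range_succ G m
  simp only [h2]
  exact (Finset.sum_range_diag_flip (s + 1) G).symm

end along

/-! ### Test functions and the fundamental lemma of the calculus of variations. -/

section testFunctions

variable {n : ℕ} {U : Set (EuclideanSpace ℝ (Fin n))} {u v : EuclideanSpace ℝ (Fin n) → ℝ}

/-- Smooth functions with compact support in `U`. -/
structure IsTestFunction (U : Set (EuclideanSpace ℝ (Fin n)))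
    (u : EuclideanSpace ℝ (Fin n) → ℝ) : Prop where
  contDiff : ContDiff ℝ ∞ u
  hasCompactSupport : HasCompactSupport u
  tsupport_subset : tsupport u ⊆ U

theorem IsTestFunction.zero : IsTestFunction U fun _ ↦ 0 where
  contDiff := contDiff_const
  hasCompactSupport := HasCompactSupport.zero
  tsupport_subset := by
    have : tsupport (fun _ : EuclideanSpace ℝ (Fin n) ↦ (0 : ℝ)) = ∅ := tsupport_eq_empty_iff.2 rfl
    simp [this]

/-- The factor `v` may be arbitrary outside `U`, since `u` vanishes near every point outside its
support. -/
theorem IsTestFunction.mul_left (hu : IsTestFunction U u) (hU : IsOpen U)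
    (hv : ContDiffOn ℝ ∞ v U) : IsTestFunction U fun t ↦ v t * u t where
  contDiff := by
    rw [contDiff_iff_contDiffAt]
    intro t
    by_cases ht : t ∈ tsupport u
    · exact (hv.contDiffAt (hU.mem_nhds (hu.tsupport_subset ht))).mul hu.contDiff.contDiffAt
    · have h0 : (fun t ↦ v t * u t) =ᶠ[𝓝 t] fun _ ↦ 0 := by
        filter_upwards [notMem_tsupport_iff_eventuallyEq.1 ht] with x hx
        simp [hx]
      exact contDiffAt_const.congr_of_eventuallyEq h0
  hasCompactSupport := hu.hasCompactSupport.mul_left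
  tsupport_subset := (tsupport_mul_subset_right).trans hu.tsupport_subset

theorem IsTestFunction.add (hu : IsTestFunction U u) (hv : IsTestFunction U v) :
    IsTestFunction U fun t ↦ u t + v t where
  contDiff := hu.contDiff.add hv.contDiff
  hasCompactSupport := HasCompactSupport.add hu.hasCompactSupport hv.hasCompactSupport
  tsupport_subset := (tsupport_add u v).trans (Set.union_subset hu.tsupport_subset hv.tsupport_subset)

theorem IsTestFunction.sum {ι : Type*} (s : Finset ι) {u : ι → EuclideanSpace ℝ (Fin n) → ℝ}
    (hu : ∀ i ∈ s, IsTestFunction U (u i)) : IsTestFunction U fun t ↦ ∑ i ∈ s, u i t := by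
  classical
  induction s using Finset.induction_on with
  | empty => simpa using IsTestFunction.zero
  | insert a s ha ih =>
    simp only [Finset.sum_insert ha]
    exact (hu a (by simp)).add (ih fun i hi ↦ hu i (by simp [hi]))

theorem IsTestFunction.iterPartial (hu : IsTestFunction U u) (L : List (Fin n)) :
    IsTestFunction U (iterPartial L u) := by
  induction L with
  | nil => exact hu
  | cons i L ih =>
    exact ⟨(ih.contDiff.fderiv_right (m := ∞) (by simp)).clm_apply contDiff_const,
      ih.hasCompactSupport.fderiv_apply (𝕜 := ℝ) _,
      (tsupport_fderiv_apply_subset ℝ _).trans ih.tsupport_subset⟩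

theorem IsTestFunction.integrable (hu : IsTestFunction U u) : MeasureTheory.Integrable u :=
  hu.contDiff.continuous.integrable_of_hasCompactSupport hu.hasCompactSupport

theorem exists_isTestFunction (hU : IsOpen U) {t : EuclideanSpace ℝ (Fin n)} (ht : t ∈ U) :
    ∃ χ, IsTestFunction U χ ∧ ∀ᶠ x in 𝓝 t, χ x = 1 := by
  obtain ⟨ε, hε, h⟩ := Metric.nhds_basis_closedBall.mem_iff.1 (hU.mem_nhds ht)
  let χ : ContDiffBump t := ⟨ε / 2, ε, by positivity, by linarith⟩
  exact ⟨χ, ⟨χ.contDiff, χ.hasCompactSupport, χ.tsupport_eq ▸ h⟩, χ.eventuallyEq_one⟩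

/-- The hypothesis gives vanishing almost everywhere in `U`, and continuity on an open set upgrades
this to every point. -/
theorem eqOn_zero_of_integral_eq_zero (hU : IsOpen U) {R : EuclideanSpace ℝ (Fin n) → ℝ}
    (hR : ContinuousOn R U) (h : ∀ g, IsTestFunction U g → ∫ t, g t * R t = 0) :
    Set.EqOn R (fun _ ↦ 0) U := by
  have h1 := hU.ae_eq_zero_of_integral_contDiff_smul_eq_zero (μ := MeasureTheory.volume)
    (hR.locallyIntegrableOn hU.measurableSet) fun g h1 h2 h3 ↦ h g ⟨h1, h2, h3⟩
  exact MeasureTheory.Measure.eqOn_open_of_ae_eq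
    ((MeasureTheory.ae_restrict_iff' hU.measurableSet).2 h1) hU hR continuousOn_const

end testFunctions

/-! ### Formal adjoints of linear differential operators under a change of frame. -/

section adjoint

variable {n N : ℕ} {U : Set (EuclideanSpace ℝ (Fin n))} {s : ℕ}
  {c c' : Fin N → Fin N → Multiset (Fin n) → EuclideanSpace ℝ (Fin n) → ℝ}

/-- The linear differential operator `(L ξ)_A = ∑ c^J_{AB} ∂_J ξ^B` of order `s`. -/
noncomputable def linOp (s : ℕ)
    (c : Fin N → Fin N → Multiset (Fin n) → EuclideanSpace ℝ (Fin n) → ℝ)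
    (ξ : Fin N → EuclideanSpace ℝ (Fin n) → ℝ) (A : Fin N) (t : EuclideanSpace ℝ (Fin n)) : ℝ :=
  ∑ B, ∑ k ∈ Finset.range (s + 1), ∑ j : Fin k → Fin n,
    c A B (tupleIndex j) t * iterPartial (List.ofFn j) (ξ B) t

/-- The formal adjoint of `linOp`. -/
noncomputable def adjOp (s : ℕ)
    (c : Fin N → Fin N → Multiset (Fin n) → EuclideanSpace ℝ (Fin n) → ℝ)
    (ξ : Fin N → EuclideanSpace ℝ (Fin n) → ℝ) (A : Fin N) (t : EuclideanSpace ℝ (Fin n)) : ℝ :=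
  ∑ B, ∑ k ∈ Finset.range (s + 1), ∑ j : Fin k → Fin n,
    (-1) ^ k * iterPartial (List.ofFn j) (fun t ↦ c B A (tupleIndex j) t * ξ B t) t

theorem isTestFunction_adjOp (hU : IsOpen U) (hc : ∀ A B J, ContDiffOn ℝ ∞ (c A B J) U)
    {ξ : Fin N → EuclideanSpace ℝ (Fin n) → ℝ} (hξ : ∀ A, IsTestFunction U (ξ A)) (A : Fin N) :
    IsTestFunction U (adjOp s c ξ A) :=
  IsTestFunction.sum _ fun B _ ↦ IsTestFunction.sum _ fun _ _ ↦ IsTestFunction.sum _ fun _ _ ↦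
    (((hξ B).mul_left hU (hc _ _ _)).iterPartial _).mul_left hU contDiffOn_const

/-- Justifies the name of `adjOp`: each summand is one iterated integration by parts. All products
are test functions, which makes every integral split over the sums. -/
theorem integral_mul_adjOp (hU : IsOpen U) (hc : ∀ A B J, ContDiffOn ℝ ∞ (c A B J) U)
    {ξ η : Fin N → EuclideanSpace ℝ (Fin n) → ℝ} (hξ : ∀ A, IsTestFunction U (ξ A))
    (hη : ∀ A, IsTestFunction U (η A)) :
    ∫ t, ∑ A, η A t * adjOp s c ξ A t = ∫ t, ∑ A, ξ A t * linOp s c η A t := by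
  simp only [adjOp, linOp, Finset.mul_sum]
  have h1 (A B : Fin N) (k : ℕ) (j : Fin k → Fin n) : IsTestFunction U fun t ↦
      η A t * ((-1) ^ k *
        iterPartial (List.ofFn j) (fun t ↦ c B A (tupleIndex j) t * ξ B t) t) :=
    ((((hξ B).mul_left hU (hc _ _ _)).iterPartial _).mul_left hU contDiffOn_const).mul_left hU
      (hη A).contDiff.contDiffOn
  have h2 (A B : Fin N) (k : ℕ) (j : Fin k → Fin n) : IsTestFunction U fun t ↦
      ξ B t * (c B A (tupleIndex j) t * iterPartial (List.ofFn j) (η A) t) :=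
    (((hη A).iterPartial _).mul_left hU (hc _ _ _)).mul_left hU (hξ B).contDiff.contDiffOn
  rw [MeasureTheory.integral_finsetSum _ fun A _ ↦ (IsTestFunction.sum _ fun B _ ↦
      IsTestFunction.sum _ fun k _ ↦ IsTestFunction.sum _ fun j _ ↦ h1 A B k j).integrable,
    MeasureTheory.integral_finsetSum _ fun B _ ↦ (IsTestFunction.sum _ fun A _ ↦
      IsTestFunction.sum _ fun k _ ↦ IsTestFunction.sum _ fun j _ ↦ h2 A B k j).integrable]
  rw [Finset.sum_congr rfl fun A _ ↦ MeasureTheory.integral_finsetSum _ fun B _ ↦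
      (IsTestFunction.sum _ fun k _ ↦ IsTestFunction.sum _ fun j _ ↦ h1 A B k j).integrable,
    Finset.sum_congr rfl fun B _ ↦ MeasureTheory.integral_finsetSum _ fun A _ ↦
      (IsTestFunction.sum _ fun k _ ↦ IsTestFunction.sum _ fun j _ ↦ h2 A B k j).integrable]
  rw [Finset.sum_comm]
  refine Finset.sum_congr rfl fun B _ ↦ Finset.sum_congr rfl fun A _ ↦ ?_
  rw [MeasureTheory.integral_finsetSum _ fun k _ ↦
      (IsTestFunction.sum _ fun j _ ↦ h1 A B k j).integrable,
    MeasureTheory.integral_finsetSum _ fun k _ ↦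
      (IsTestFunction.sum _ fun j _ ↦ h2 A B k j).integrable]
  refine Finset.sum_congr rfl fun k _ ↦ ?_
  rw [MeasureTheory.integral_finsetSum _ fun j _ ↦ (h1 A B k j).integrable,
    MeasureTheory.integral_finsetSum _ fun j _ ↦ (h2 A B k j).integrable]
  refine Finset.sum_congr rfl fun j _ ↦ ?_
  have hf := (hξ B).mul_left hU (hc B A (tupleIndex j))
  have := integral_mul_iterPartial hf.contDiff hf.hasCompactSupport (hη A).contDiff (List.ofFn j)
  rw [List.length_ofFn] at this
  have h3 : (fun t ↦ ξ B t * (c B A (tupleIndex j) t * iterPartial (List.ofFn j) (η A) t)) =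
      fun t ↦ c B A (tupleIndex j) t * ξ B t * iterPartial (List.ofFn j) (η A) t := by
    funext t; ring
  rw [h3, this, ← MeasureTheory.integral_const_mul]
  congr 1
  funext t
  ring

/-- The adjoint is a local operator, which later allows cutting off its argument. -/
theorem adjOp_congr {V : Set (EuclideanSpace ℝ (Fin n))} (hV : IsOpen V)
    {ξ ξ' : Fin N → EuclideanSpace ℝ (Fin n) → ℝ} (h : ∀ A, Set.EqOn (ξ A) (ξ' A) V) (A : Fin N) :
    Set.EqOn (adjOp s c ξ A) (adjOp s c ξ' A) V := by
  intro t ht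
  refine Finset.sum_congr rfl fun B _ ↦ Finset.sum_congr rfl fun k _ ↦
    Finset.sum_congr rfl fun j _ ↦ ?_
  rw [iterPartial_congr hV (f := fun t ↦ c B A (tupleIndex j) t * ξ B t)
    (g := fun t ↦ c B A (tupleIndex j) t * ξ' B t) (fun x hx ↦ by simp only [h B hx]) _ ht]

theorem isTestFunction_linOp (hU : IsOpen U) (hc : ∀ A B J, ContDiffOn ℝ ∞ (c A B J) U)
    {ξ : Fin N → EuclideanSpace ℝ (Fin n) → ℝ} (hξ : ∀ A, IsTestFunction U (ξ A)) (A : Fin N) :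
    IsTestFunction U (linOp s c ξ A) :=
  IsTestFunction.sum _ fun B _ ↦ IsTestFunction.sum _ fun _ _ ↦ IsTestFunction.sum _ fun _ _ ↦
    ((hξ B).iterPartial _).mul_left hU (hc _ _ _)

/-- Move the adjoint from `ξ` to the operator on `η`, apply the frame change `hL` to `η`, and move
the operator for `c'` back. The zeroth order term returns with its indices exchanged, so symmetry of
`S` is what reproduces it. -/
theorem integral_mul_adjOp_change_frame (hU : IsOpen U)
    (hc : ∀ A B J, ContDiffOn ℝ ∞ (c A B J) U) (hc' : ∀ A B J, ContDiffOn ℝ ∞ (c' A B J) U)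
    {M S : Fin N → Fin N → EuclideanSpace ℝ (Fin n) → ℝ} (hM : ∀ C A, ContDiffOn ℝ ∞ (M C A) U)
    (hS : ∀ A B, ContDiffOn ℝ ∞ (S A B) U) (hSsymm : ∀ A B, ∀ t ∈ U, S A B t = S B A t)
    (hL : ∀ ξ : Fin N → EuclideanSpace ℝ (Fin n) → ℝ, (∀ A, IsTestFunction U (ξ A)) →
      ∀ A, ∀ t ∈ U, linOp s c ξ A t =
        ∑ C, M C A t * linOp s c' (fun C t ↦ ∑ B, M C B t * ξ B t) C t + ∑ B, S A B t * ξ B t)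
    {ξ η : Fin N → EuclideanSpace ℝ (Fin n) → ℝ} (hξ : ∀ A, IsTestFunction U (ξ A))
    (hη : ∀ A, IsTestFunction U (η A)) :
    ∫ t, ∑ A, η A t * (adjOp s c ξ A t - (∑ C, M C A t *
      adjOp s c' (fun C t ↦ ∑ B, M C B t * ξ B t) C t + ∑ B, S A B t * ξ B t)) = 0 := by
  have hMt {ζ : Fin N → EuclideanSpace ℝ (Fin n) → ℝ} (hζ : ∀ A, IsTestFunction U (ζ A))
      (C : Fin N) : IsTestFunction U fun t ↦ ∑ B, M C B t * ζ B t :=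
    IsTestFunction.sum _ fun B _ ↦ (hζ B).mul_left hU (hM C B)
  have hP : IsTestFunction U fun t ↦ ∑ A, η A t * adjOp s c ξ A t :=
    IsTestFunction.sum _ fun A _ ↦
      (isTestFunction_adjOp hU hc hξ A).mul_left hU (hη A).contDiff.contDiffOn
  have hQ : IsTestFunction U fun t ↦ ∑ C, (∑ B, M C B t * η B t) *
      adjOp s c' (fun C t ↦ ∑ B, M C B t * ξ B t) C t :=
    IsTestFunction.sum _ fun C _ ↦ (isTestFunction_adjOp hU hc' (hMt hξ) C).mul_left hU
      (hMt hη C).contDiff.contDiffOn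
  have hQ' : IsTestFunction U fun t ↦ ∑ C, (∑ B, M C B t * ξ B t) *
      linOp s c' (fun C t ↦ ∑ B, M C B t * η B t) C t :=
    IsTestFunction.sum _ fun C _ ↦ (isTestFunction_linOp hU hc' (hMt hη) C).mul_left hU
      (hMt hξ C).contDiff.contDiffOn
  have hZ : IsTestFunction U fun t ↦ ∑ A, η A t * ∑ B, S A B t * ξ B t :=
    IsTestFunction.sum _ fun A _ ↦ (IsTestFunction.sum _ fun B _ ↦
      (hξ B).mul_left hU (hS A B)).mul_left hU (hη A).contDiff.contDiffOn
  -- The relation `hL` holds on `U` only; outside `U` both sides vanish together with `ξ`.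
  have hpt (t : EuclideanSpace ℝ (Fin n)) : ∑ A, ξ A t * linOp s c η A t =
      (∑ C, (∑ B, M C B t * ξ B t) * linOp s c' (fun C t ↦ ∑ B, M C B t * η B t) C t) +
        ∑ A, η A t * ∑ B, S A B t * ξ B t := by
    by_cases ht : t ∈ U
    · simp only [hL η hη _ t ht, mul_add, Finset.sum_add_distrib, Finset.mul_sum, Finset.sum_mul]
      congr 1
      · rw [Finset.sum_comm]
        exact Finset.sum_congr rfl fun C _ ↦ Finset.sum_congr rfl fun A _ ↦ by ring
      · rw [Finset.sum_comm]
        refine Finset.sum_congr rfl fun A _ ↦ Finset.sum_congr rfl fun B _ ↦ ?_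
        rw [hSsymm B A t ht]
        ring
    · have h0 (A : Fin N) : ξ A t = 0 :=
        image_eq_zero_of_notMem_tsupport fun h ↦ ht ((hξ A).tsupport_subset h)
      simp [h0]
  have hsplit (t : EuclideanSpace ℝ (Fin n)) : ∑ A, η A t * (adjOp s c ξ A t - (∑ C, M C A t *
      adjOp s c' (fun C t ↦ ∑ B, M C B t * ξ B t) C t + ∑ B, S A B t * ξ B t)) =
      ∑ A, η A t * adjOp s c ξ A t - ((∑ C, (∑ B, M C B t * η B t) *
        adjOp s c' (fun C t ↦ ∑ B, M C B t * ξ B t) C t) +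
          ∑ A, η A t * ∑ B, S A B t * ξ B t) := by
    simp only [mul_sub, mul_add, Finset.sum_sub_distrib, Finset.sum_add_distrib]
    congr 2
    simp only [Finset.mul_sum, Finset.sum_mul]
    rw [Finset.sum_comm]
    exact Finset.sum_congr rfl fun C _ ↦ Finset.sum_congr rfl fun A _ ↦ by ring
  simp only [hsplit]
  rw [MeasureTheory.integral_sub hP.integrable (hQ.add hZ).integrable,
    MeasureTheory.integral_add hQ.integrable hZ.integrable, integral_mul_adjOp hU hc hξ hη,
    integral_mul_adjOp hU hc' (hMt hξ) (hMt hη)]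
  simp only [hpt]
  rw [MeasureTheory.integral_add hQ'.integrable hZ.integrable, sub_self]

/-- If two differential operators are related by a change of frame `M`, up to a symmetric
zeroth order operator, then so are their formal adjoints. -/
theorem adjOp_change_frame (hU : IsOpen U) (hc : ∀ A B J, ContDiffOn ℝ ∞ (c A B J) U)
    (hc' : ∀ A B J, ContDiffOn ℝ ∞ (c' A B J) U)
    {M S : Fin N → Fin N → EuclideanSpace ℝ (Fin n) → ℝ} (hM : ∀ C A, ContDiffOn ℝ ∞ (M C A) U)
    (hS : ∀ A B, ContDiffOn ℝ ∞ (S A B) U) (hSsymm : ∀ A B, ∀ t ∈ U, S A B t = S B A t)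
    (hL : ∀ ξ : Fin N → EuclideanSpace ℝ (Fin n) → ℝ, (∀ A, IsTestFunction U (ξ A)) →
      ∀ A, ∀ t ∈ U, linOp s c ξ A t =
        ∑ C, M C A t * linOp s c' (fun C t ↦ ∑ B, M C B t * ξ B t) C t + ∑ B, S A B t * ξ B t)
    {ξ : Fin N → EuclideanSpace ℝ (Fin n) → ℝ} (hξ : ∀ A, ContDiffOn ℝ ∞ (ξ A) U) (A : Fin N)
    {t : EuclideanSpace ℝ (Fin n)} (ht : t ∈ U) :
    adjOp s c ξ A t =
      ∑ C, M C A t * adjOp s c' (fun C t ↦ ∑ B, M C B t * ξ B t) C t + ∑ B, S A B t * ξ B t := by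
  have hMt {ζ : Fin N → EuclideanSpace ℝ (Fin n) → ℝ} (hζ : ∀ A, IsTestFunction U (ζ A))
      (C : Fin N) : IsTestFunction U fun t ↦ ∑ B, M C B t * ζ B t :=
    IsTestFunction.sum _ fun B _ ↦ (hζ B).mul_left hU (hM C B)
  have test {ζ : Fin N → EuclideanSpace ℝ (Fin n) → ℝ} (hζ : ∀ A, IsTestFunction U (ζ A)) :
      Set.EqOn (fun t ↦ adjOp s c ζ A t - (∑ C, M C A t *
        adjOp s c' (fun C t ↦ ∑ B, M C B t * ζ B t) C t + ∑ B, S A B t * ζ B t)) (fun _ ↦ 0) U := by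
    refine eqOn_zero_of_integral_eq_zero hU ?_ fun g hg ↦ ?_
    · refine ContinuousOn.sub (isTestFunction_adjOp hU hc hζ A).contDiff.continuous.continuousOn
        (ContinuousOn.add ?_ ?_)
      · exact continuousOn_finsetSum _ fun C _ ↦ (hM C A).continuousOn.mul
          (isTestFunction_adjOp hU hc' (hMt hζ) C).contDiff.continuous.continuousOn
      · exact continuousOn_finsetSum _ fun B _ ↦ (hS A B).continuousOn.mul
          (hζ B).contDiff.continuous.continuousOn
    -- Testing with `η` concentrated in the component `A` isolates that component of the identity.
    · have := integral_mul_adjOp_change_frame hU hc hc' hM hS hSsymm hL hζ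
        (η := fun B ↦ if B = A then g else fun _ ↦ 0) (fun B ↦ by
          split_ifs
          exacts [hg, IsTestFunction.zero])
      convert this using 2
      funext t
      symm
      rw [Finset.sum_eq_single A]
      · simp
      · intro B _ hB; simp [hB]
      · simp
  -- A cutoff equal to `1` near `t` reduces a general smooth `ξ` to a test function without changing
  -- either side at `t`.
  obtain ⟨χ, hχ, h1⟩ := exists_isTestFunction hU ht
  obtain ⟨V, hV1, hV, htV⟩ := eventually_nhds_iff.1 h1
  have hζ (B : Fin N) : IsTestFunction U fun t ↦ ξ B t * χ t := hχ.mul_left hU (hξ B)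
  have heq (B : Fin N) : Set.EqOn (ξ B) (fun t ↦ ξ B t * χ t) V := fun x hx ↦ by
    simp [hV1 x hx]
  have heq' (C : Fin N) : Set.EqOn (fun t ↦ ∑ B, M C B t * ξ B t)
      (fun t ↦ ∑ B, M C B t * (ξ B t * χ t)) V := fun x hx ↦ by
    simp [hV1 x hx]
  rw [adjOp_congr hV heq A htV, sub_eq_zero.1 (test hζ ht)]
  congr 1
  · refine Finset.sum_congr rfl fun C _ ↦ ?_
    rw [adjOp_congr hV heq' C htV]
  · refine Finset.sum_congr rfl fun B _ ↦ ?_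
    exact congrArg (S A B t * ·) (heq B htV).symm

end adjoint

/-! ### Prolongation of maps to jets and its derivative. -/

section prolong

variable {N n r : ℕ} {U : Set (EuclideanSpace ℝ (Fin n))}
  {g ξ : EuclideanSpace ℝ (Fin n) → EuclideanSpace ℝ (Fin N)}
  {O : Set (EuclideanSpace ℝ (Fin N))} {Φ : EuclideanSpace ℝ (Fin N) → EuclideanSpace ℝ (Fin N)}

/-- The action of a map `Φ` on `r`-jets. -/
noncomputable def prolong (r : ℕ) (Φ : EuclideanSpace ℝ (Fin N) → EuclideanSpace ℝ (Fin N))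
    (y : JetCoord N n r) : JetCoord N n r :=
  jet r fun t ↦ Φ (taylorPoly y t)

/-- The jet of `Φ ∘ g` depends on `g` only through its jet, so `g` may be replaced by its Taylor
polynomial at `t`. -/
theorem prolong_jetAt (hU : IsOpen U) (hg : ContDiffOn ℝ ∞ g U) (hO : IsOpen O)
    (hΦ : ContDiffOn ℝ ∞ Φ O) {t : EuclideanSpace ℝ (Fin n)} (ht : t ∈ U) (hgt : g t ∈ O) :
    prolong r Φ (jetAt r g t) = jetAt r (fun u ↦ Φ (g u)) t := by
  rw [jetAt_eq_jet r fun u ↦ Φ (g u)]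
  funext A J
  have hU' : IsOpen ((· + t) ⁻¹' U) := hU.preimage (by fun_prop)
  refine iterPartial_comp_eq_of_jet_eq (r := r) hU' (by simpa using ht)
    (taylorPoly_contDiff_right _).contDiffOn
    (hg.comp (contDiff_id.add contDiff_const).contDiffOn fun u hu ↦ hu) ?_ hO ?_
    (contDiffOn_coord hΦ A) J.1.toList (by simpa using J.2)
  · rw [jet_taylorPoly, jetAt_eq_jet]
    rfl
  · rw [taylorPoly_zero, jetBase_jetAt]
    exact hgt

theorem jetAt_add_smul (hU : IsOpen U) (hg : ContDiffOn ℝ ∞ g U) (hξ : ContDiffOn ℝ ∞ ξ U) (ε : ℝ)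
    {t : EuclideanSpace ℝ (Fin n)} (ht : t ∈ U) :
    jetAt r (fun u ↦ g u + ε • ξ u) t = jetAt r g t + ε • jetAt r ξ t := by
  funext A J
  have h1 := iterPartial_add hU (contDiffOn_coord hg A)
    (contDiffOn_const.mul (contDiffOn_coord hξ A)) J.1.toList (g := fun u ↦ ε * ξ u A) ht
  refine h1.trans ?_
  simp only
  rw [iterPartial_const_mul hU (contDiffOn_coord hξ A) ε J.1.toList ht]
  rfl

/-- The parameter derivative commutes with the partial derivatives in `t`, so it is the jet of the
pointwise derivative `DΦ(g) ξ`. -/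
theorem hasDerivAt_jetAt_comp (hU : IsOpen U) (hg : ContDiffOn ℝ ∞ g U)
    (hξ : ContDiffOn ℝ ∞ ξ U) (hO : IsOpen O) (hΦ : ContDiffOn ℝ ∞ Φ O)
    {t : EuclideanSpace ℝ (Fin n)} (ht : t ∈ U) (hgt : g t ∈ O) :
    HasDerivAt (fun ε : ℝ ↦ jetAt r (fun u ↦ Φ (g u + ε • ξ u)) t)
      (jetAt r (fun u ↦ fderiv ℝ Φ (g u) (ξ u)) t) 0 := by
  rw [hasDerivAt_pi]
  intro A
  rw [hasDerivAt_pi]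
  intro J
  have hsnd : ContDiffOn ℝ ∞ (fun q : ℝ × EuclideanSpace ℝ (Fin n) ↦ g q.2 + q.1 • ξ q.2)
      (Prod.snd ⁻¹' U) :=
    (hg.comp contDiff_snd.contDiffOn fun _ h ↦ h).add
      (contDiff_fst.contDiffOn.smul (hξ.comp contDiff_snd.contDiffOn fun _ h ↦ h))
  have hP : IsOpen ((Prod.snd ⁻¹' U) ∩ (fun q : ℝ × EuclideanSpace ℝ (Fin n) ↦
      g q.2 + q.1 • ξ q.2) ⁻¹' O) :=
    hsnd.continuousOn.isOpen_inter_preimage (hU.preimage continuous_snd) hO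
  have hF : ContDiffOn ℝ ∞ (fun q : ℝ × EuclideanSpace ℝ (Fin n) ↦ Φ (g q.2 + q.1 • ξ q.2) A)
      ((Prod.snd ⁻¹' U) ∩ (fun q : ℝ × EuclideanSpace ℝ (Fin n) ↦ g q.2 + q.1 • ξ q.2) ⁻¹' O) :=
    (contDiffOn_coord hΦ A).comp (hsnd.mono Set.inter_subset_left) fun q hq ↦ hq.2
  have h1 := hasDerivAt_iterPartial hP hF J.1.toList (q := (0, t)) ⟨ht, by simpa using hgt⟩
  refine h1.congr_deriv (Eq.symm ?_)
  have hV : IsOpen (U ∩ g ⁻¹' O) := hg.continuousOn.isOpen_inter_preimage hU hO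
  refine iterPartial_congr hV (fun u hu ↦ ?_) _ ⟨ht, hgt⟩
  have hd : HasFDerivAt Φ (fderiv ℝ Φ (g u)) (g u + (0 : ℝ) • ξ u) := by
    rw [zero_smul, add_zero]
    exact ((hΦ.contDiffAt (hO.mem_nhds hu.2)).differentiableAt (by simp)).hasFDerivAt
  have hl : HasDerivAt (fun ε : ℝ ↦ g u + ε • ξ u) (ξ u) 0 := by
    simpa using ((hasDerivAt_id (0 : ℝ)).smul_const (ξ u)).const_add (g u)
  have h2 := (coordProj N A).hasFDerivAt.comp_hasDerivAt (0 : ℝ) (hd.comp_hasDerivAt (0 : ℝ) hl)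
  exact h2.deriv.symm

/-- The line `y + ε a` consists of the jets of `taylorPoly y + ε taylorPoly a`; differentiate the
jets of the images under `Φ` at `ε = 0`. This is how jets of vector fields along `g` transform. -/
theorem fderiv_prolong (hO : IsOpen O) (hΦ : ContDiffOn ℝ ∞ Φ O) {y : JetCoord N n r}
    (hy : jetBase y ∈ O) (hd : DifferentiableAt ℝ (prolong r Φ) y) (a : JetCoord N n r) :
    fderiv ℝ (prolong r Φ) y a = jet r fun t ↦ fderiv ℝ Φ (taylorPoly y t) (taylorPoly a t) := by
  have hs (y : JetCoord N n r) : ContDiffOn ℝ ∞ (taylorPoly (N := N) y) Set.univ :=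
    (taylorPoly_contDiff_right y).contDiffOn
  have hl : HasDerivAt (fun ε : ℝ ↦ y + ε • a) a 0 := by
    simpa using ((hasDerivAt_id (0 : ℝ)).smul_const a).const_add y
  have hd' : HasFDerivAt (prolong r Φ) (fderiv ℝ (prolong r Φ) y) (y + (0 : ℝ) • a) := by
    rw [zero_smul, add_zero]
    exact hd.hasFDerivAt
  have h1 := hd'.comp_hasDerivAt (0 : ℝ) hl
  have h2 := hasDerivAt_jetAt_comp (r := r) isOpen_univ (hs y) (hs a) hO hΦ (Set.mem_univ 0)
    (by rwa [taylorPoly_zero])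
  refine h1.unique (h2.congr_of_eventuallyEq ?_)
  have hcont : Filter.Tendsto (fun ε : ℝ ↦ jetBase (y + ε • a)) (𝓝 0) (𝓝 (jetBase y)) := by
    have : Continuous fun ε : ℝ ↦ jetBase (y + ε • a) :=
      continuous_jetBase.comp (by fun_prop)
    simpa using this.tendsto 0
  filter_upwards [hcont.eventually (hO.mem_nhds hy)] with ε hε
  have h3 : jetAt r (fun u ↦ taylorPoly y u + ε • taylorPoly a u) 0 = y + ε • a := by
    rw [jetAt_add_smul isOpen_univ (hs y) (hs a) ε (Set.mem_univ 0), jetAt_zero, jetAt_zero,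
      jet_taylorPoly, jet_taylorPoly]
  have h4 := prolong_jetAt (r := r) isOpen_univ ((hs y).add ((hs a).const_smul ε)) hO hΦ
    (Set.mem_univ 0) (by
      rw [← h3, jetBase_jetAt] at hε
      exact hε)
  simp only [Function.comp]
  rw [← h4, ← h3]

end prolong

/-! ### Linearization of the equation and invariance of the Helmholtz-Sonin bilinear form. -/

section linearization

variable {N n r s : ℕ} {U : Set (EuclideanSpace ℝ (Fin n))}
  {g ξ : EuclideanSpace ℝ (Fin n) → EuclideanSpace ℝ (Fin N)}
  {O : Set (EuclideanSpace ℝ (Fin N))} {Φ : EuclideanSpace ℝ (Fin N) → EuclideanSpace ℝ (Fin N)}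
  {Ω Ω' : Set (JetCoord N n r)} {f f' : Fin N → JetCoord N n r → ℝ}

/-- The coefficients of the linearization of the differential operator `g ↦ f (j^r g)` at `g`. -/
noncomputable def linCoeff (f : Fin N → JetCoord N n r → ℝ)
    (g : EuclideanSpace ℝ (Fin n) → EuclideanSpace ℝ (Fin N)) (A B : Fin N)
    (J : Multiset (Fin n)) (t : EuclideanSpace ℝ (Fin n)) : ℝ :=
  weightedPartial B J (f A) (jetAt r g t)

theorem linOp_linCoeff (hs : s ≤ r) (hfs : ∀ A, HasOrder s (f A)) (hU : IsOpen U)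
    (hξ : ContDiffOn ℝ ∞ ξ U) {t : EuclideanSpace ℝ (Fin n)} (ht : t ∈ U) (A : Fin N) :
    linOp s (linCoeff f g) (fun B t ↦ ξ t B) A t =
      fderiv ℝ (f A) (jetAt r g t) (jetAt r ξ t) := by
  rw [(hfs A).fderiv_eq_sum hs, linOp, Finset.sum_comm]
  refine Finset.sum_congr rfl fun k hk ↦ ?_
  rw [Finset.sum_comm]
  refine Finset.sum_congr rfl fun j _ ↦ Finset.sum_congr rfl fun B _ ↦ ?_
  have hk := Finset.mem_range.1 hk
  have h1 : jetEntry B (tupleIndex j) (jetAt r ξ t) = _ :=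
    jetEntry_jetAt hU hξ ht B (List.ofFn j) (by rw [List.length_ofFn]; omega)
  rw [h1, linCoeff]

theorem contDiffOn_linCoeff (hU : IsOpen U) (hg : ContDiffOn ℝ ∞ g U) (hΩ : IsOpen Ω)
    (hgΩ : Set.MapsTo (jetAt r g) U Ω) (hf : ∀ A, ContDiffOn ℝ ∞ (f A) Ω) (A B : Fin N)
    (J : Multiset (Fin n)) : ContDiffOn ℝ ∞ (linCoeff f g A B J) U :=
  (contDiffOn_weightedPartial hΩ (hf A) B J).comp (contDiffOn_jetAt hU hg r) hgΩ

/-- The bilinear form `∑ 𝓗^J_{AB} a^B_J b^A` defined by the Helmholtz-Sonin expressions. -/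
noncomputable def helmholtzBilin (s : ℕ) (f : Fin N → JetCoord N n r → ℝ)
    (y a b : JetCoord N n r) : ℝ :=
  ∑ k ∈ Finset.range (s + 1), ∑ j : Fin k → Fin n, ∑ A : Fin N, ∑ B : Fin N,
    helmholtzExpr s f (tupleIndex j) A B y * (jetEntry B (tupleIndex j) a * jetEntry A 0 b)

/-- The intrinsic meaning of the Helmholtz-Sonin expressions: they are the coefficients of the
linearization minus its formal adjoint, hence measure its failure to be formally self-adjoint. -/
theorem helmholtzBilin_jetAt (hs : 2 * s ≤ r) (hU : IsOpen U) (hg : ContDiffOn ℝ ∞ g U)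
    (hΩ : IsOpen Ω) (hgΩ : Set.MapsTo (jetAt r g) U Ω) (hf : ∀ A, ContDiffOn ℝ ∞ (f A) Ω)
    (hfs : ∀ A, HasOrder s (f A)) {η : EuclideanSpace ℝ (Fin n) → EuclideanSpace ℝ (Fin N)}
    (hξ : ContDiffOn ℝ ∞ ξ U) {t : EuclideanSpace ℝ (Fin n)} (ht : t ∈ U) :
    helmholtzBilin s f (jetAt r g t) (jetAt r ξ t) (jetAt r η t) =
      ∑ A, η t A * (linOp s (linCoeff f g) (fun B t ↦ ξ t B) A t -
        adjOp s (linCoeff f g) (fun B t ↦ ξ t B) A t) := by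
  have hη (A : Fin N) : jetEntry A 0 (jetAt r η t) = η t A := by
    simp [jetEntry, jetAt, iterPartial]
  have hadj (A : Fin N) : adjOp s (linCoeff f g) (fun B t ↦ ξ t B) A t =
      ∑ B, ∑ k ∈ Finset.range (s + 1), ∑ j : Fin k → Fin n,
        (-1) ^ k * lieEuler s A (tupleIndex j) (f B) (jetAt r g t) *
          iterPartial (List.ofFn j) (fun t ↦ ξ t B) t :=
    Finset.sum_congr rfl fun B _ ↦ (sum_lieEuler_jetAt hU hg hΩ hgΩ (hf B) (hfs B) hs A
      (contDiffOn_coord hξ B) ht).symm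
  simp only [hadj, linOp, ← Finset.sum_sub_distrib, Finset.mul_sum, helmholtzBilin]
  have h1 (k : ℕ) (hk : k ∈ Finset.range (s + 1)) (j : Fin k → Fin n) (A B : Fin N) :
      helmholtzExpr s f (tupleIndex j) A B (jetAt r g t) *
        (jetEntry B (tupleIndex j) (jetAt r ξ t) * jetEntry A 0 (jetAt r η t)) =
      η t A * (linCoeff f g A B (tupleIndex j) t * iterPartial (List.ofFn j) (fun t ↦ ξ t B) t -
        (-1) ^ k * lieEuler s A (tupleIndex j) (f B) (jetAt r g t) *
          iterPartial (List.ofFn j) (fun t ↦ ξ t B) t) := by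
    have hk := Finset.mem_range.1 hk
    have h2 : jetEntry B (tupleIndex j) (jetAt r ξ t) = _ :=
      jetEntry_jetAt hU hξ ht B (List.ofFn j) (by rw [List.length_ofFn]; omega)
    rw [h2, hη, linCoeff, helmholtzExpr, card_tupleIndex]
    ring
  rw [Finset.sum_congr rfl fun k hk ↦ Finset.sum_congr rfl fun j _ ↦
    Finset.sum_congr rfl fun A _ ↦ Finset.sum_congr rfl fun B _ ↦ h1 k hk j A B]
  simp only [Finset.sum_comm (s := (Finset.univ : Finset (Fin _ → Fin n)))
    (t := (Finset.univ : Finset (Fin N)))]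
  rw [Finset.sum_comm]
  refine Finset.sum_congr rfl fun A _ ↦ ?_
  rw [Finset.sum_comm]

/-- The Hessian term in the transformation law of the linearization. -/
noncomputable def hessianTerm (r : ℕ) (Φ : EuclideanSpace ℝ (Fin N) → EuclideanSpace ℝ (Fin N))
    (f' : Fin N → JetCoord N n r → ℝ) (g : EuclideanSpace ℝ (Fin n) → EuclideanSpace ℝ (Fin N))
    (A B : Fin N) (t : EuclideanSpace ℝ (Fin n)) : ℝ :=
  ∑ C, f' C (jetAt r (fun u ↦ Φ (g u)) t) *
    fderiv ℝ (fderiv ℝ Φ) (g t) (EuclideanSpace.single B 1) (EuclideanSpace.single A 1) C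

theorem sum_mul_single (v : EuclideanSpace ℝ (Fin N)) :
    v = ∑ B, v B • EuclideanSpace.single B (1 : ℝ) := by
  ext A
  simp [Finset.sum_apply, Pi.single_apply]

/-- Differentiate the transformation law `hlaw` along the variation `g + ε ξ`. The product rule
gives the linearization in the new coordinates, applied to `DΦ ξ`, and a Hessian term from varying
`DΦ` itself. -/
theorem fderiv_change_frame (hU : IsOpen U) (hg : ContDiffOn ℝ ∞ g U) (hξ : ContDiffOn ℝ ∞ ξ U)
    (hO : IsOpen O) (hΦ : ContDiffOn ℝ ∞ Φ O) (hΩ : IsOpen Ω) (hΩ' : IsOpen Ω')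
    (hf : ∀ A, ContDiffOn ℝ ∞ (f A) Ω) (hf' : ∀ A, ContDiffOn ℝ ∞ (f' A) Ω')
    (hΩO : ∀ y ∈ Ω, jetBase y ∈ O) (hΩΩ' : ∀ y ∈ Ω, prolong r Φ y ∈ Ω')
    (hlaw : ∀ y ∈ Ω, ∀ A, f A y = ∑ C, f' C (prolong r Φ y) *
      fderiv ℝ Φ (jetBase y) (EuclideanSpace.single A 1) C)
    (hgΩ : Set.MapsTo (jetAt r g) U Ω) {t : EuclideanSpace ℝ (Fin n)} (ht : t ∈ U) (A : Fin N) :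
    fderiv ℝ (f A) (jetAt r g t) (jetAt r ξ t) =
      ∑ C, fderiv ℝ Φ (g t) (EuclideanSpace.single A 1) C *
        fderiv ℝ (f' C) (jetAt r (fun u ↦ Φ (g u)) t)
          (jetAt r (fun u ↦ fderiv ℝ Φ (g u) (ξ u)) t) +
      ∑ B, hessianTerm r Φ f' g A B t * ξ t B := by
  have hgO {u} (hu : u ∈ U) : g u ∈ O := by simpa [jetBase_jetAt] using hΩO _ (hgΩ hu)
  have hl : HasDerivAt (fun ε : ℝ ↦ jetAt r g t + ε • jetAt r ξ t) (jetAt r ξ t) 0 := by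
    simpa using ((hasDerivAt_id (0 : ℝ)).smul_const (jetAt r ξ t)).const_add (jetAt r g t)
  have hl' : HasDerivAt (fun ε : ℝ ↦ g t + ε • ξ t) (ξ t) 0 := by
    simpa using ((hasDerivAt_id (0 : ℝ)).smul_const (ξ t)).const_add (g t)
  have h1 : HasDerivAt (fun ε : ℝ ↦ f A (jetAt r g t + ε • jetAt r ξ t))
      (fderiv ℝ (f A) (jetAt r g t) (jetAt r ξ t)) 0 := by
    have hd : HasFDerivAt (f A) (fderiv ℝ (f A) (jetAt r g t))
        (jetAt r g t + (0 : ℝ) • jetAt r ξ t) := by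
      rw [zero_smul, add_zero]
      exact (((hf A).contDiffAt (hΩ.mem_nhds (hgΩ ht))).differentiableAt (by simp)).hasFDerivAt
    exact hd.comp_hasDerivAt (0 : ℝ) hl
  have hjet0 : jetAt r (fun u ↦ Φ (g u)) t = jetAt r (fun u ↦ Φ (g u + (0 : ℝ) • ξ u)) t := by
    simp
  have h2 (C : Fin N) : HasDerivAt (fun ε : ℝ ↦ f' C (jetAt r (fun u ↦ Φ (g u + ε • ξ u)) t))
      (fderiv ℝ (f' C) (jetAt r (fun u ↦ Φ (g u)) t)
          (jetAt r (fun u ↦ fderiv ℝ Φ (g u) (ξ u)) t)) 0 := by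
    have hmem : jetAt r (fun u ↦ Φ (g u)) t ∈ Ω' := by
      rw [← prolong_jetAt hU hg hO hΦ ht (hgO ht)]
      exact hΩΩ' _ (hgΩ ht)
    have hd := (((hf' C).contDiffAt (hΩ'.mem_nhds hmem)).differentiableAt (by simp)).hasFDerivAt
    have hd' : HasFDerivAt (f' C) (fderiv ℝ (f' C) (jetAt r (fun u ↦ Φ (g u)) t))
        (jetAt r (fun u ↦ Φ (g u + (0 : ℝ) • ξ u)) t) := hjet0 ▸ hd
    exact hd'.comp_hasDerivAt (0 : ℝ) (hasDerivAt_jetAt_comp hU hg hξ hO hΦ ht (hgO ht))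
  have h3 (C : Fin N) : HasDerivAt
      (fun ε : ℝ ↦ fderiv ℝ Φ (g t + ε • ξ t) (EuclideanSpace.single A 1) C)
      (fderiv ℝ (fderiv ℝ Φ) (g t) (ξ t) (EuclideanSpace.single A 1) C) 0 := by
    have hd : HasFDerivAt (fderiv ℝ Φ) (fderiv ℝ (fderiv ℝ Φ) (g t)) (g t + (0 : ℝ) • ξ t) := by
      rw [zero_smul, add_zero]
      have hc : ContDiffAt ℝ ∞ (fderiv ℝ Φ) (g t) :=
        (hΦ.contDiffAt (hO.mem_nhds (hgO ht))).fderiv_right (m := ∞) (by simp)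
      exact (hc.differentiableAt (by simp)).hasFDerivAt
    have hv : HasDerivAt (fun ε : ℝ ↦ fderiv ℝ Φ (g t + ε • ξ t) (EuclideanSpace.single A 1))
        (fderiv ℝ (fderiv ℝ Φ) (g t) (ξ t) (EuclideanSpace.single A 1)) 0 := by
      have hcomp : HasDerivAt (fun ε : ℝ ↦ fderiv ℝ Φ (g t + ε • ξ t))
          (fderiv ℝ (fderiv ℝ Φ) (g t) (ξ t)) 0 := hd.comp_hasDerivAt (0 : ℝ) hl'
      have := hcomp.clm_apply (hasDerivAt_const (0 : ℝ) (EuclideanSpace.single A (1 : ℝ)))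
      rw [map_zero, add_zero] at this
      exact this
    exact (coordProj N C).hasFDerivAt.comp_hasDerivAt (0 : ℝ) hv
  have h4 := HasDerivAt.fun_sum (u := Finset.univ) fun C _ ↦ (h2 C).mul (h3 C)
  have h5 : (fun ε : ℝ ↦ f A (jetAt r g t + ε • jetAt r ξ t)) =ᶠ[𝓝 0] fun ε ↦
      ∑ C, f' C (jetAt r (fun u ↦ Φ (g u + ε • ξ u)) t) *
        fderiv ℝ Φ (g t + ε • ξ t) (EuclideanSpace.single A 1) C := by
    have hcont : Filter.Tendsto (fun ε : ℝ ↦ jetAt r g t + ε • jetAt r ξ t) (𝓝 0)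
        (𝓝 (jetAt r g t)) := by
      simpa using hl.continuousAt.tendsto
    filter_upwards [hcont.eventually (hΩ.mem_nhds (hgΩ ht))] with ε hε
    rw [hlaw _ hε]
    have hge : ContDiffOn ℝ ∞ (fun u ↦ g u + ε • ξ u) U := hg.add (hξ.const_smul ε)
    have hb := hΩO _ hε
    rw [← jetAt_add_smul hU hg hξ ε ht, jetBase_jetAt] at hb ⊢
    rw [prolong_jetAt hU hge hO hΦ ht hb]
  have h6 := h1.unique (h4.congr_of_eventuallyEq h5)
  rw [h6, Finset.sum_add_distrib]
  simp only [zero_smul, add_zero]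
  congr 1
  · exact Finset.sum_congr rfl fun C _ ↦ mul_comm _ _
  · simp only [hessianTerm, Finset.sum_mul]
    rw [Finset.sum_comm]
    refine Finset.sum_congr rfl fun C _ ↦ ?_
    conv_lhs => rw [sum_mul_single (ξ t)]
    simp only [map_sum, map_smul, sum_apply, smul_apply, smul_eq_mul, WithLp.ofLp_sum, WithLp.ofLp_smul, Finset.sum_apply, Pi.smul_apply]
    rw [Finset.mul_sum]
    exact Finset.sum_congr rfl fun B _ ↦ by ring

/-- The Helmholtz-Sonin bilinear form is invariant under changes of coordinates. -/
theorem helmholtzBilin_change_frame (hs : 2 * s ≤ r)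
    (hO : IsOpen O) (hΦ : ContDiffOn ℝ ∞ Φ O) (hΩ : IsOpen Ω) (hΩ' : IsOpen Ω')
    (hf : ∀ A, ContDiffOn ℝ ∞ (f A) Ω) (hf' : ∀ A, ContDiffOn ℝ ∞ (f' A) Ω')
    (hfs : ∀ A, HasOrder s (f A)) (hfs' : ∀ A, HasOrder s (f' A))
    (hΩO : ∀ y ∈ Ω, jetBase y ∈ O) (hΩΩ' : ∀ y ∈ Ω, prolong r Φ y ∈ Ω')
    (hlaw : ∀ y ∈ Ω, ∀ A, f A y = ∑ C, f' C (prolong r Φ y) *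
      fderiv ℝ Φ (jetBase y) (EuclideanSpace.single A 1) C)
    {y : JetCoord N n r} (hy : y ∈ Ω) (hd : DifferentiableAt ℝ (prolong r Φ) y)
    (a b : JetCoord N n r) :
    helmholtzBilin s f y a b = helmholtzBilin s f' (prolong r Φ y)
      (fderiv ℝ (prolong r Φ) y a) (fderiv ℝ (prolong r Φ) y b) := by
  have hsm (y : JetCoord N n r) : ContDiff ℝ ∞ (taylorPoly (N := N) y) :=
    taylorPoly_contDiff_right y
  -- Realize the point and the two vectors as jets at `0` of polynomial maps, so that the statement
  -- becomes one about differential operators along `g`.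
  set g := taylorPoly y
  set ξ := taylorPoly a
  set η := taylorPoly b
  have hjc : Continuous (jetAt r g) := continuousOn_univ.1
    (contDiffOn_jetAt isOpen_univ (hsm y).contDiffOn r).continuousOn
  -- The adjoint involves derivatives and test functions, so the identities are needed on a
  -- neighbourhood of `0`, not only at `0`.
  set U := jetAt r g ⁻¹' Ω
  have hU : IsOpen U := hΩ.preimage hjc
  have h0 : (0 : EuclideanSpace ℝ (Fin n)) ∈ U := by
    change jet r (taylorPoly y) ∈ Ω
    rwa [jet_taylorPoly]
  have hgΩ : Set.MapsTo (jetAt r g) U Ω := fun _ h ↦ h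
  have hg : ContDiffOn ℝ ∞ g U := (hsm y).contDiffOn
  have hξ : ContDiffOn ℝ ∞ ξ U := (hsm a).contDiffOn
  have hgO : Set.MapsTo g U O := fun u hu ↦ by simpa [jetBase_jetAt] using hΩO _ (hgΩ hu)
  have hΦg : ContDiffOn ℝ ∞ (fun u ↦ Φ (g u)) U := hΦ.comp hg hgO
  have hpro {u} (hu : u ∈ U) : prolong r Φ (jetAt r g u) = jetAt r (fun u ↦ Φ (g u)) u :=
    prolong_jetAt hU hg hO hΦ hu (hgO hu)
  have hgΩ' : Set.MapsTo (jetAt r fun u ↦ Φ (g u)) U Ω' := fun u hu ↦ by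
    rw [← hpro hu]
    exact hΩΩ' _ hu
  have hJ {ζ : EuclideanSpace ℝ (Fin n) → EuclideanSpace ℝ (Fin N)} (hζ : ContDiffOn ℝ ∞ ζ U) :
      ContDiffOn ℝ ∞ (fun u ↦ fderiv ℝ Φ (g u) (ζ u)) U :=
    ((hΦ.fderiv_of_isOpen hO (by simp)).comp hg hgO).clm_apply hζ
  let M : Fin N → Fin N → EuclideanSpace ℝ (Fin n) → ℝ := fun C A t ↦
    fderiv ℝ Φ (g t) (EuclideanSpace.single A 1) C
  have hM (C A : Fin N) : ContDiffOn ℝ ∞ (M C A) U := contDiffOn_coord (hJ contDiffOn_const) C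
  have hMsum (v : EuclideanSpace ℝ (Fin N)) (t : EuclideanSpace ℝ (Fin n)) (C : Fin N) :
      fderiv ℝ Φ (g t) v C = ∑ B, M C B t * v B := by
    conv_lhs => rw [sum_mul_single v]
    simp [M, mul_comm]
  have hS (A B : Fin N) : ContDiffOn ℝ ∞ (hessianTerm r Φ f' g A B) U := by
    refine ContDiffOn.sum fun C _ ↦ ((hf' C).comp (contDiffOn_jetAt hU hΦg r) hgΩ').mul ?_
    have h2 : ContDiffOn ℝ ∞ (fderiv ℝ (fderiv ℝ Φ)) O :=
      (hΦ.fderiv_of_isOpen hO (m := ∞) (by simp)).fderiv_of_isOpen hO (by simp)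
    exact contDiffOn_coord
      (((h2.comp hg hgO).clm_apply contDiffOn_const).clm_apply contDiffOn_const) C
  -- The decisive symmetry: second derivatives of the coordinate change commute.
  have hSsymm (A B : Fin N) (t : EuclideanSpace ℝ (Fin n)) (ht : t ∈ U) :
      hessianTerm r Φ f' g A B t = hessianTerm r Φ f' g B A t := by
    have hsym : IsSymmSndFDerivAt ℝ Φ (g t) :=
      (hΦ.contDiffAt (hO.mem_nhds (hgO ht))).isSymmSndFDerivAt (by
        rw [minSmoothness_of_isRCLikeNormedField]
        exact WithTop.coe_le_coe.2 (le_top : (2 : ℕ∞) ≤ ⊤))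
    refine Finset.sum_congr rfl fun C _ ↦ ?_
    rw [hsym]
  have hL (ζ : EuclideanSpace ℝ (Fin n) → EuclideanSpace ℝ (Fin N)) (hζ : ContDiffOn ℝ ∞ ζ U)
      (A : Fin N) (t : EuclideanSpace ℝ (Fin n)) (ht : t ∈ U) :
      linOp s (linCoeff f g) (fun B t ↦ ζ t B) A t =
        ∑ C, M C A t * linOp s (linCoeff f' fun u ↦ Φ (g u))
          (fun C t ↦ ∑ B, M C B t * ζ t B) C t + ∑ B, hessianTerm r Φ f' g A B t * ζ t B := by
    rw [linOp_linCoeff (by omega) hfs hU hζ ht, fderiv_change_frame hU hg hζ hO hΦ hΩ hΩ' hf hf'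
      hΩO hΩΩ' hlaw hgΩ ht A]
    simp only [← hMsum]
    congr 1
    refine Finset.sum_congr rfl fun C _ ↦ ?_
    rw [← linOp_linCoeff (by omega) hfs' hU (hJ hζ) ht]
  have hadj (A : Fin N) := adjOp_change_frame (s := s) hU (contDiffOn_linCoeff hU hg hΩ hgΩ hf)
    (contDiffOn_linCoeff hU hΦg hΩ' hgΩ' hf') hM hS hSsymm
    (fun ζ hζ ↦ hL (fun t ↦ WithLp.toLp 2 fun B ↦ ζ B t)
      (PiLp.contDiff_toLp.comp_contDiffOn (contDiffOn_pi.2 fun B ↦ (hζ B).contDiff.contDiffOn)))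
    (contDiffOn_coord hξ) A h0
  rw [fderiv_prolong hO hΦ (hΩO y hy) hd, fderiv_prolong hO hΦ (hΩO y hy) hd]
  have h1 := helmholtzBilin_jetAt hs hU hg hΩ hgΩ hf hfs hξ (η := η) h0
  have h2 := helmholtzBilin_jetAt hs hU hΦg hΩ' hgΩ' hf' hfs' (hJ hξ)
    (η := fun u ↦ fderiv ℝ Φ (g u) (η u)) h0
  rw [← hpro h0] at h2
  simp only [jetAt_zero] at h1 h2
  simp only [g, ξ, η, jet_taylorPoly] at h1 h2
  rw [h1, h2]
  -- The same Hessian term occurs in the operator and in its adjoint, and cancels in the difference.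
  simp only [hadj, hL ξ hξ _ 0 h0, add_sub_add_right_eq_sub, hMsum, g, ξ]
  simp only [← Finset.sum_sub_distrib, ← mul_sub, Finset.mul_sum, Finset.sum_mul]
  rw [Finset.sum_comm]
  exact Finset.sum_congr rfl fun C _ ↦ Finset.sum_congr rfl fun A _ ↦ by ring

end linearization

/-! ### Truncation of jets and coordinate functions as linear maps. -/

section restrict

variable {N n s t : ℕ}

theorem contDiff_jetRestrict (h : s ≤ t) :
    ContDiff ℝ ∞ (jetRestrict h : JetCoord N n t → JetCoord N n s) := by
  unfold jetRestrict
  fun_prop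

/-- Lets the law for the components on `T^s_n X` be read on `T^t_n X`, where the bilinear form
lives. -/
theorem jetRestrict_prolong (h : s ≤ t) {O : Set (EuclideanSpace ℝ (Fin N))} (hO : IsOpen O)
    {Φ : EuclideanSpace ℝ (Fin N) → EuclideanSpace ℝ (Fin N)} (hΦ : ContDiffOn ℝ ∞ Φ O)
    {y : JetCoord N n t} (hy : jetBase y ∈ O) :
    jetRestrict h (prolong t Φ y) = prolong s Φ (jetRestrict h y) := by
  have h1 : jetRestrict h y = jetAt s (taylorPoly y) 0 := by
    conv_lhs => rw [← jet_taylorPoly y]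
    rfl
  rw [h1, prolong_jetAt isOpen_univ (taylorPoly_contDiff_right y).contDiffOn hO hΦ (Set.mem_univ _)
    (by rwa [taylorPoly_zero])]
  rfl

/-- The coordinate function `x^A_J` as a continuous linear map. -/
noncomputable def jetEntryCLM (r : ℕ) (A : Fin N) (J : Multiset (Fin n)) :
    JetCoord N n r →L[ℝ] ℝ :=
  LinearMap.toContinuousLinearMap
    { toFun := jetEntry A J
      map_add' := fun x y ↦ by simp only [jetEntry]; split_ifs <;> simp
      map_smul' := fun c y ↦ by simp only [jetEntry]; split_ifs <;> simp }

theorem jetEntryCLM_apply (A : Fin N) (J : Multiset (Fin n)) (y : JetCoord N n t) :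
    jetEntryCLM t A J y = jetEntry A J y := rfl

theorem hasFDerivAt_jetEntry (A : Fin N) (J : Multiset (Fin n)) (y : JetCoord N n t) :
    HasFDerivAt (jetEntry A J) (jetEntryCLM t A J) y :=
  (jetEntryCLM t A J).hasFDerivAt

end restrict

/-! ### Associated charts: tangent coordinates and the transformation law of the components. -/

section charts

variable {N n r : ℕ} {X : Type*} [TopologicalSpace X]
  [ChartedSpace (EuclideanSpace ℝ (Fin N)) X] [IsManifold (𝓡 N) ∞ X]

theorem Chart.isOpen_trans_source (e e' : Chart N X) :
    IsOpen (e.1.target ∩ e.1.symm ⁻¹' e'.1.source) :=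
  e.1.isOpen_inter_preimage_symm e'.1.open_source

theorem Chart.symm_mem_source_iff (e e' : Chart N X) {y : JetCoord N n r}
    (hy : jetBase y ∈ e.1.target) : (e.velocityChart r n).symm y ∈ (e'.velocityChart r n).source ↔
      e.1.symm (jetBase y) ∈ e'.1.source := by
  change (e.taylorGerm y).1 0 ∈ e'.1.source ↔ e.1.symm (jetBase y) ∈ e'.1.source
  rw [e.taylorGerm_zero hy]

theorem Chart.velocityChart_symm (e e' : Chart N X) {y : JetCoord N n r}
    (hy : jetBase y ∈ e.1.target ∩ e.1.symm ⁻¹' e'.1.source) :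
    e'.velocityChart r n ((e.velocityChart r n).symm y) = prolong r (e'.1 ∘ e.1.symm) y := by
  change e'.coords ((e.taylorGerm y).vel r) = _
  rw [e'.coords_vel, e.jet_taylorGerm e' hy.1]
  · rfl
  · rw [e.taylorGerm_zero hy.1]
    exact hy.2

theorem Chart.differentiableAt_prolong (e e' : Chart N X) {y : JetCoord N n r}
    (hy : jetBase y ∈ e.1.target ∩ e.1.symm ⁻¹' e'.1.source) :
    DifferentiableAt ℝ (prolong r (e'.1 ∘ e.1.symm)) y :=
  ((contDiffOn_jet_comp e e').contDiffAt
    (((e.isOpen_trans_source e').preimage continuous_jetBase).mem_nhds hy)).differentiableAt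
      (by simp)

theorem Chart.mdifferentiableAt_velocityChart (e : Chart N X) {p : Velocity r N n X}
    (hp : p ∈ (e.velocityChart r n).source) :
    MDifferentiableAt 𝓘(ℝ, JetCoord N n r) 𝓘(ℝ, JetCoord N n r) (e.velocityChart r n) p :=
  mdifferentiableAt_atlas ((mem_atlas_velocity _).2 ⟨e, rfl⟩) hp

theorem Chart.mdifferentiableAt_velocityChart_symm (e : Chart N X) {y : JetCoord N n r}
    (hy : y ∈ (e.velocityChart r n).target) :
    MDifferentiableAt 𝓘(ℝ, JetCoord N n r) 𝓘(ℝ, JetCoord N n r) (e.velocityChart r n).symm y :=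
  mdifferentiableAt_atlas_symm ((mem_atlas_velocity _).2 ⟨e, rfl⟩) hy

/-- The coordinate representation of a tangent vector in the chart `ψ^r`. -/
noncomputable def Chart.coframe (e : Chart N X) (p : Velocity r N n X) :
    VelocityTangent p →L[ℝ] JetCoord N n r :=
  mfderiv 𝓘(ℝ, JetCoord N n r) 𝓘(ℝ, JetCoord N n r) (e.velocityChart r n) p

theorem Chart.dCoord_apply (e : Chart N X) (A : Fin N) (J : Multiset (Fin n))
    {p : Velocity r N n X} (hp : p ∈ (e.velocityChart r n).source) (v : VelocityTangent p) :
    e.dCoord A J p v = jetEntry A J (e.coframe p v) := by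
  have h1 := HasMFDerivAt.comp p (hasFDerivAt_jetEntry A J (e.velocityChart r n p)).hasMFDerivAt
    (e.mdifferentiableAt_velocityChart hp).hasMFDerivAt
  have h2 := congrArg (fun l : VelocityTangent p →L[ℝ] ℝ ↦ l v) h1.mfderiv
  exact h2.trans (jetEntryCLM_apply A J _)

theorem Chart.coframe_change (e e' : Chart N X) {p : Velocity r N n X}
    (hp : p ∈ (e.velocityChart r n).source) (hp' : p ∈ (e'.velocityChart r n).source)
    (v : VelocityTangent p) : e'.coframe p v =
      fderiv ℝ (prolong r (e'.1 ∘ e.1.symm)) (e.velocityChart r n p) (e.coframe p v) := by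
  have hmem {q : Velocity r N n X} (hq : q ∈ (e.velocityChart r n).source)
      (hq' : q ∈ (e'.velocityChart r n).source) :
      jetBase (e.velocityChart r n q) ∈ e.1.target ∩ e.1.symm ⁻¹' e'.1.source := by
    have h1 := (e.velocityChart r n).map_source hq
    refine ⟨h1, (e.symm_mem_source_iff e' h1).1 ?_⟩
    rwa [(e.velocityChart r n).left_inv hq]
  have h1 := HasMFDerivAt.comp p
    (e.differentiableAt_prolong e' (hmem hp hp')).hasFDerivAt.hasMFDerivAt
    (e.mdifferentiableAt_velocityChart hp).hasMFDerivAt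
  have h2 : e'.velocityChart r n =ᶠ[𝓝 p] prolong r (e'.1 ∘ e.1.symm) ∘ e.velocityChart r n := by
    filter_upwards [(e.velocityChart r n).open_source.mem_nhds hp,
      (e'.velocityChart r n).open_source.mem_nhds hp'] with q hq hq'
    rw [Function.comp, ← e.velocityChart_symm e' (hmem hq hq'), (e.velocityChart r n).left_inv hq]
  have h3 := (h1.congr_of_eventuallyEq h2).mfderiv
  exact congrArg (fun l : VelocityTangent p →L[ℝ] JetCoord N n r ↦ l v) h3

theorem Chart.coframe_frame (e : Chart N X) {y : JetCoord N n r}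
    (hy : y ∈ (e.velocityChart r n).target) (a : JetCoord N n r) :
    e.coframe ((e.velocityChart r n).symm y) (e.frame y a) = a := by
  have h1 := HasMFDerivAt.comp y
    (e.mdifferentiableAt_velocityChart ((e.velocityChart r n).map_target hy)).hasMFDerivAt
    (e.mdifferentiableAt_velocityChart_symm hy).hasMFDerivAt
  have h2 : id =ᶠ[𝓝 y] e.velocityChart r n ∘ (e.velocityChart r n).symm := by
    filter_upwards [(e.velocityChart r n).open_target.mem_nhds hy] with z hz
    exact ((e.velocityChart r n).right_inv hz).symm
  have h3 := hasMFDerivAt_unique (h1.congr_of_eventuallyEq h2) (hasMFDerivAt_id y)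
  exact congrArg (fun l : JetCoord N n r →L[ℝ] JetCoord N n r ↦ l a) h3

/-- The order zero part of a prolonged map is `Φ` itself, so only the order zero part of `a`
contributes. -/
theorem jetEntry_zero_fderiv_prolong {O : Set (EuclideanSpace ℝ (Fin N))} (hO : IsOpen O)
    {Φ : EuclideanSpace ℝ (Fin N) → EuclideanSpace ℝ (Fin N)} (hΦ : ContDiffOn ℝ ∞ Φ O)
    {y : JetCoord N n r} (hy : jetBase y ∈ O) (hd : DifferentiableAt ℝ (prolong r Φ) y)
    (a : JetCoord N n r) (C : Fin N) :
    jetEntry C 0 (fderiv ℝ (prolong r Φ) y a) = fderiv ℝ Φ (jetBase y) (jetBase a) C := by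
  rw [fderiv_prolong hO hΦ hy hd]
  simp [jetEntry, jet, iterPartial, taylorPoly_zero]

/-- Evaluate the expression `T'_C dx'^C` in the second chart on the vector `∂/∂x^A` of the first.
The absence of higher order differentials `dx'^C_J` is what gives a law involving only the first
derivatives of the coordinate change. -/
theorem OneForm.IsDifferentialEquationOn.component_eq {T : OneForm r N n X}
    {W : Set (Velocity r N n X)} (hT : T.IsDifferentialEquationOn W) (e e' : Chart N X)
    {y : JetCoord N n r} (hy : jetBase y ∈ e.1.target ∩ e.1.symm ⁻¹' e'.1.source)
    (hyW : (e.velocityChart r n).symm y ∈ W) (A : Fin N) :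
    T.component e A y = ∑ C, T.component e' C (prolong r (e'.1 ∘ e.1.symm) y) *
      fderiv ℝ (e'.1 ∘ e.1.symm) (jetBase y) (EuclideanSpace.single A 1) C := by
  have hy1 : y ∈ (e.velocityChart r n).target := hy.1
  have hp := (e.velocityChart r n).map_target hy1
  have hp' := (e.symm_mem_source_iff e' hy.1).2 hy.2
  have hb : jetBase (Pi.single A (Pi.single ⟨0, Nat.zero_le r⟩ 1) : JetCoord N n r) =
      EuclideanSpace.single A 1 := by
    ext B
    by_cases hB : B = A
    · subst hB; simp [jetBase]
    · simp [jetBase, hB]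
  rw [OneForm.component, hT.2 e' _ ⟨hp', hyW⟩]
  simp only [sum_apply, smul_apply, smul_eq_mul]
  refine Finset.sum_congr rfl fun C _ ↦ ?_
  rw [e'.dCoord_apply C 0 hp', e.coframe_change e' hp hp', e.coframe_frame hy1,
    e.velocityChart_symm e' hy, (e.velocityChart r n).right_inv hy1,
    jetEntry_zero_fderiv_prolong (e.isOpen_trans_source e') (e.contDiffOn_trans e') hy
      (e.differentiableAt_prolong e' hy), hb]

theorem OneForm.SmoothOn.contDiffOn_component {T : OneForm r N n X} {W : Set (Velocity r N n X)}
    (hT : T.SmoothOn W) (e : Chart N X) (A : Fin N) : ContDiffOn ℝ ∞ (T.component e A)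
      ((e.velocityChart r n).target ∩ (e.velocityChart r n).symm ⁻¹' W) :=
  (hT e).clm_apply contDiffOn_const

end charts

/-! ### Pulling back to order `t`: chart independence and smoothness of the local forms. -/

section projection

variable {N n s t : ℕ} {X : Type*} [TopologicalSpace X]
  [ChartedSpace (EuclideanSpace ℝ (Fin N)) X] [IsManifold (𝓡 N) ∞ X]

theorem Chart.proj_symm (h : s ≤ t) (e : Chart N X) {y : JetCoord N n t}
    (hy : jetBase y ∈ e.1.target) : Velocity.proj h ((e.velocityChart t n).symm y) =
      (e.velocityChart s n).symm (jetRestrict h y) := by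
  have hy' : jetBase (jetRestrict h y) ∈ e.1.target := hy
  change (e.taylorGerm y).vel s = (e.taylorGerm (jetRestrict h y)).vel s
  refine Quotient.sound (s := Germ.setoid s N n X) ⟨?_, e, ?_, ?_⟩
  · rw [e.taylorGerm_zero hy, e.taylorGerm_zero hy']
    rfl
  · rw [e.taylorGerm_zero hy]
    exact e.1.map_target hy
  · rw [e.jet_taylorGerm_self hy']
    exact congrArg (jetRestrict h) (e.jet_taylorGerm_self hy)

/-- The coordinates in the chart `ψ^t` of the points over `W`. -/
def Chart.domainOver (h : s ≤ t) (e : Chart N X) (W : Set (Velocity s N n X)) :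
    Set (JetCoord N n t) :=
  jetRestrict h ⁻¹' ((e.velocityChart s n).target ∩ (e.velocityChart s n).symm ⁻¹' W)

theorem Chart.isOpen_domainOver (h : s ≤ t) (e : Chart N X) {W : Set (Velocity s N n X)}
    (hW : IsOpen W) : IsOpen (e.domainOver h W) :=
  ((e.velocityChart s n).isOpen_inter_preimage_symm hW).preimage
    (contDiff_jetRestrict h).continuous

theorem Chart.mem_domainOver_iff (h : s ≤ t) (e : Chart N X) {W : Set (Velocity s N n X)}
    {y : JetCoord N n t} : y ∈ e.domainOver h W ↔
      y ∈ (e.velocityChart t n).target ∩ (e.velocityChart t n).symm ⁻¹' (Velocity.proj h ⁻¹' W) := by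
  have h1 : y ∈ e.domainOver h W ↔ jetBase y ∈ e.1.target ∧
    (e.velocityChart s n).symm (jetRestrict h y) ∈ W := Iff.rfl
  rw [h1]
  refine and_congr_right fun hy ↦ ?_
  rw [Set.mem_preimage, Set.mem_preimage, e.proj_symm h hy]

theorem Chart.contDiffOn_component_jetRestrict (h : s ≤ t) (e : Chart N X)
    {W : Set (Velocity s N n X)} {T : OneForm s N n X} (hT : T.SmoothOn W) (A : Fin N) :
    ContDiffOn ℝ ∞ (fun y : JetCoord N n t ↦ T.component e A (jetRestrict h y))
      (e.domainOver h W) :=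
  (hT.contDiffOn_component e A).comp (contDiff_jetRestrict h).contDiffOn fun _ hy ↦ hy

/-- The wedge product antisymmetrizes the bilinear form, so invariance of the latter suffices. -/
theorem Chart.helmholtzForm_apply (h : s ≤ t) (e : Chart N X) (T : OneForm s N n X)
    {p : Velocity t N n X} (hp : p ∈ (e.velocityChart t n).source)
    (v : Fin 2 → VelocityTangent p) : e.helmholtzForm h T p v =
      helmholtzBilin s (fun C y ↦ T.component e C (jetRestrict h y)) (e.velocityChart t n p)
        (e.coframe p (v 0)) (e.coframe p (v 1)) -
      helmholtzBilin s (fun C y ↦ T.component e C (jetRestrict h y)) (e.velocityChart t n p)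
        (e.coframe p (v 1)) (e.coframe p (v 0)) := by
  simp only [Chart.helmholtzForm, helmholtzBilin, ContinuousAlternatingMap.sum_apply,
    ContinuousAlternatingMap.smul_apply, wedge_apply, e.dCoord_apply _ _ hp,
    ← Finset.sum_sub_distrib, smul_eq_mul, mul_sub]

theorem Chart.helmholtzForm_eq (hst : 2 * s ≤ t) (h : s ≤ t) {W : Set (Velocity s N n X)}
    (hW : IsOpen W) {T : OneForm s N n X} (hT : T.IsDifferentialEquationOn W) (e e' : Chart N X)
    {p : Velocity t N n X} (hp : p ∈ (e.velocityChart t n).source)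
    (hp' : p ∈ (e'.velocityChart t n).source) (hpW : Velocity.proj h p ∈ W) :
    e.helmholtzForm h T p = e'.helmholtzForm h T p := by
  have hO := e.isOpen_trans_source e'
  have hΦ := e.contDiffOn_trans e'
  set O := e.1.target ∩ e.1.symm ⁻¹' e'.1.source with hOdef
  set Φ := e'.1 ∘ e.1.symm
  -- The jets over `W` whose base point lies in both charts: here the transformation law of the
  -- components is available.
  have hΩ : IsOpen (e.domainOver h W ∩ jetBase ⁻¹' O : Set (JetCoord N n t)) :=
    (e.isOpen_domainOver h hW).inter (hO.preimage continuous_jetBase)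
  have hpro (y : JetCoord N n t) (hy : y ∈ e.domainOver h W ∩ jetBase ⁻¹' O) :
      prolong t Φ y ∈ e'.domainOver h W := by
    rw [e'.mem_domainOver_iff, ← e.velocityChart_symm e' hy.2]
    have hs := (e.symm_mem_source_iff e' hy.2.1).2 hy.2.2
    refine ⟨(e'.velocityChart t n).map_source hs, ?_⟩
    rw [Set.mem_preimage, (e'.velocityChart t n).left_inv hs]
    exact ((e.mem_domainOver_iff h).1 hy.1).2
  have hpt : e.velocityChart t n p ∈ e.domainOver h W ∩ jetBase ⁻¹' O := by
    have ht := (e.velocityChart t n).map_source hp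
    refine ⟨(e.mem_domainOver_iff h).2 ⟨ht, ?_⟩, ht, (e.symm_mem_source_iff e' ht).1 ?_⟩
    · rw [Set.mem_preimage, (e.velocityChart t n).left_inv hp]
      exact hpW
    · rwa [(e.velocityChart t n).left_inv hp]
  have key := helmholtzBilin_change_frame (r := t) (s := s)
    (f := fun C y ↦ T.component e C (jetRestrict h y))
    (f' := fun C y ↦ T.component e' C (jetRestrict h y)) hst hO hΦ hΩ (e'.isOpen_domainOver h hW)
    (fun A ↦ (e.contDiffOn_component_jetRestrict h hT.1 A).mono Set.inter_subset_left)
    (fun A ↦ e'.contDiffOn_component_jetRestrict h hT.1 A)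
    (fun A ↦ hasOrder_comp_jetRestrict h _) (fun A ↦ hasOrder_comp_jetRestrict h _)
    (fun y hy ↦ hy.2) hpro
    (fun y hy A ↦ by
      rw [jetRestrict_prolong h hO hΦ hy.2]
      exact hT.component_eq e e' (y := jetRestrict h y) hy.2 hy.1.2 A)
    hpt (e.differentiableAt_prolong e' hpt.2)
  have hy' : e'.velocityChart t n p = prolong t Φ (e.velocityChart t n p) := by
    rw [← e.velocityChart_symm e' hpt.2, (e.velocityChart t n).left_inv hp]
  ext v
  rw [e.helmholtzForm_apply h T hp, e'.helmholtzForm_apply h T hp', key, key, hy',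
    e.coframe_change e' hp hp', e.coframe_change e' hp hp']

/-- Composed with the coordinate frame, the differentials of the coordinates become the constant
covectors `jetEntryCLM`, leaving only the smooth coefficients. -/
theorem Chart.contDiffOn_helmholtzForm (h : s ≤ t) (e : Chart N X) {W : Set (Velocity s N n X)}
    (hW : IsOpen W) {T : OneForm s N n X} (hT : T.SmoothOn W) :
    ContDiffOn ℝ ∞ (fun y : JetCoord N n t ↦
      (e.helmholtzForm h T ((e.velocityChart t n).symm y)).compContinuousLinearMap (e.frame y))
      (e.domainOver h W) := by
  have h1 : ContDiffOn ℝ ∞ (fun y : JetCoord N n t ↦ ∑ k ∈ Finset.range (s + 1),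
      ∑ j : Fin k → Fin n, ∑ A : Fin N, ∑ B : Fin N,
        helmholtzExpr s (fun C y ↦ T.component e C (jetRestrict h y)) (tupleIndex j) A B y •
          wedge (jetEntryCLM t B (tupleIndex j)) (jetEntryCLM t A 0)) (e.domainOver h W) :=
    ContDiffOn.sum fun k _ ↦ ContDiffOn.sum fun j _ ↦ ContDiffOn.sum fun A _ ↦
      ContDiffOn.sum fun B _ ↦ (contDiffOn_helmholtzExpr (e.isOpen_domainOver h hW) s
        (fun A ↦ e.contDiffOn_component_jetRestrict h hT A) _ A B).smul contDiffOn_const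
  refine h1.congr fun y hy ↦ ?_
  have hy1 := ((e.mem_domainOver_iff h).1 hy).1
  ext v
  have h2 := e.helmholtzForm_apply h T ((e.velocityChart t n).map_target hy1)
    (fun i ↦ e.frame y (v i))
  refine h2.trans ?_
  simp only [e.coframe_frame hy1, (e.velocityChart t n).right_inv hy1, helmholtzBilin,
    ContinuousAlternatingMap.sum_apply, ContinuousAlternatingMap.smul_apply, wedge_apply,
    jetEntryCLM_apply, ← Finset.sum_sub_distrib, smul_eq_mul, mul_sub]

end projection

end HelmholtzSonin

/-! ### Gluing the local forms. -/

theorem mainTheorem9 {N n : ℕ} (hn : 1 ≤ n) (hnN : n ≤ N) (X : Type*) [TopologicalSpace X]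
    [ChartedSpace (EuclideanSpace ℝ (Fin N)) X] [IsManifold (𝓡 N) ∞ X]
    {s t : ℕ} (hst : 2 * s ≤ t) (W : Set (Velocity s N n X)) (hW : IsOpen W)
    (T : OneForm s N n X) (hT : T.IsDifferentialEquationOn W) :
    ∃ H : TwoForm t N n X,
      H.SmoothOn (Velocity.proj (by omega : s ≤ t) ⁻¹' W) ∧
      ∀ e : Chart N X, ∀ p ∈ (e.velocityChart t n).source ∩ Velocity.proj (by omega : s ≤ t) ⁻¹' W,
        H p = e.helmholtzForm (by omega : s ≤ t) T p := by
  have h : s ≤ t := by omega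
  have hH (e : Chart N X) (p : Velocity t N n X)
      (hp : p ∈ (e.velocityChart t n).source ∩ Velocity.proj h ⁻¹' W) :
      (exists_chart (N := N) p.base).choose.helmholtzForm h T p = e.helmholtzForm h T p :=
    Chart.helmholtzForm_eq hst h hW hT _ e (exists_chart (N := N) p.base).choose_spec hp.1 hp.2
  -- At each point use an arbitrary chart around its base point. By `hH` the choice does not matter
  -- over `W`, so near any point there the form may be computed in one fixed chart, which gives
  -- smoothness.
  refine ⟨fun p ↦ (exists_chart (N := N) p.base).choose.helmholtzForm h T p, fun e ↦ ?_, hH⟩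
  have hdom : (e.velocityChart t n).target ∩
      (e.velocityChart t n).symm ⁻¹' (Velocity.proj h ⁻¹' W) = e.domainOver h W :=
    Set.ext fun y ↦ (e.mem_domainOver_iff h).symm
  rw [hdom]
  refine (e.contDiffOn_helmholtzForm h hW hT.1).congr fun y hy ↦ ?_
  obtain ⟨hy1, hy2⟩ := (e.mem_domainOver_iff h).1 hy
  simp only
  rw [hH e _ ⟨(e.velocityChart t n).map_target hy1, hy2⟩]
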